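/- Let $\Gamma$ be a group with a finite symmetric generating set $S$ whose Cayley graph has no cycle of odd length (in particular $e\notin S$). For $x\in\Gamma$ let $\mathcal S(x)$ be the set of successors of $x$, i.e. the neighbours $y$ of $x$ in the Cayley graph with $d(e,y)=d(e,x)+1$. Let $T$ be a finite set, $t:\Gamma\to T$ a map and $M$ a real matrix indexed by $T$ such that $(T,t,M)$ is a type system: for all $i,j\in T$ and all but finitely many $x\in\Gamma$ with $t(x)=j$ one has $\mathrm{Card}\{y\in\mathcal S(x) : t(y)=i\}=M_{ij}$. Assume that $M$ is Perron–Frobenius, i.e. $M$ has nonnegative entries and some power $M^n$, $n\ge 1$, has only positive entries. Put $p_j=|S|-\sum_i M_{ij}$ and $\tilde M_{ij}=M_{ij}/p_i$. Let $e^v$ be the dominating eigenvalue of $\tilde M$, and let $A=(A_i)_{i\in T}$ be a corresponding eigenvector with positive entries, $\tilde M A=e^vA$. Let $D$ be the diagonal matrix with entries $A_i$, let $M'=D^{-1/2}MD^{1/2}$ and $\lambda=\max_{|q|=1}\langle M'q,q\rangle$, the maximum being over the Euclidean unit sphere of $\mathbb R^T$. Consider the random walk on $Y=\mathbb Z\times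 T$ with transition probabilities $$p((n,j)\to(n+1,i))=\frac{M_{ij}}{|S|},\qquad p((n,j)\to(n-1,i))=e^{-v}\,\frac{A_iM_{ji}}{A_j|S|},$$ all other transitions having probability $0$. Then: 1. These are transition probabilities of a Markov chain: they are nonnegative, and for each $(n,j)\in Y$ the probabilities of the transitions out of $(n,j)$ sum to $1$. 2. For every $y\in Y$ the limit $\rho_Y=\lim_{n\to\infty}\mathbb P_y(X_{2n}=y)^{1/2n}$ exists, does not depend on $y$, and $\rho_Y=2e^{-v/2}\lambda/|S|$. 3. The spectral radius $\rho_\Gamma=\lim_{n\to\infty}\mathbb P_e(X_{2n}=e)^{1/2n}$ of the simple random walk on $\Gamma$ (from $x$ to $xs$ with probability $1/|S|$ for each $s\in S$) exists and satisfies $\rho_\Gamma\ge\rho_Y$. -/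

import Mathlib

open Filter Topology

/-! ### Markov chains on a discrete state space -/

/-- `p x y` (the probability of the transition `x → y`) is a genuine transition probability:
the entries are nonnegative and the probabilities of all transitions out of `x` sum to one. -/
def IsTransitionProbability {X : Type*} (p : X → X → ℝ) : Prop :=
  (∀ x y, 0 ≤ p x y) ∧ ∀ x, HasSum (p x) 1

open Classical in
/-- The `n`-step transition probabilities: `nStep p n x y` is the probability that the chain with
transition probabilities `p` started at `x` is at `y` at time `n`. -/
noncomputable def nStep {X : Type*} (p : X → X → ℝ) : ℕ → X → X → ℝ
  | 0 => fun x y => if x = y then 1 else 0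
  | n + 1 => fun x y => ∑' z, p x z * nStep p n z y

/-- The chain has spectral radius `ρ`: for every starting point `x`, the sequence
`ℙ_x(X_{2n} = x) ^ (1 / 2n)` converges to `ρ`. -/
def HasSpectralRadius {X : Type*} (p : X → X → ℝ) (ρ : ℝ) : Prop :=
  ∀ x, Tendsto (fun n : ℕ => (nStep p (2 * n) x x) ^ (1 / (2 * (n : ℝ)))) atTop (𝓝 ρ)

open Classical in
/-- The simple random walk on a group: from `x` one goes to `x * s` with probability `1 / |S|`,
for every `s ∈ S`. -/
noncomputable def simpleRandomWalk {Γ : Type*} [Group Γ] (S : Finset Γ) (x y : Γ) : ℝ :=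
  if x⁻¹ * y ∈ S then 1 / (S.card : ℝ) else 0

/-! ### Groups, Cayley graphs and type systems -/

/-- `S` is a symmetric generating set of the group. -/
def IsSymmetricGenerating {Γ : Type*} [Group Γ] (S : Finset Γ) : Prop :=
  (∀ s ∈ S, s⁻¹ ∈ S) ∧ Subgroup.closure (S : Set Γ) = ⊤

/-- The Cayley graph has no cycle of odd length. Loops (cycles of length one) are not recorded by
Mathlib's simple graph, they are excluded by the first condition. -/
def NoOddCycle {Γ : Type*} [Group Γ] (S : Finset Γ) : Prop :=
  (1 : Γ) ∉ S ∧
    ∀ (x : Γ) (w : (SimpleGraph.mulCayley (S : Set Γ)).Walk x x), w.IsCycle → ¬ Odd w.length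

/-- The successors of `x`: the neighbours of `x` in the Cayley graph that are one step further
from the identity. -/
def successors {Γ : Type*} [Group Γ] (S : Finset Γ) (x : Γ) : Set Γ :=
  {y | (SimpleGraph.mulCayley (S : Set Γ)).Adj x y ∧
    (SimpleGraph.mulCayley (S : Set Γ)).dist 1 y =
      (SimpleGraph.mulCayley (S : Set Γ)).dist 1 x + 1}

/-- `(T, t, M)` is a type system: for all types `i` and `j`, all but finitely many points of type
`j` have exactly `M i j` successors of type `i`. -/
def IsTypeSystem {Γ T : Type*} [Group Γ] (S : Finset Γ) (t : Γ → T) (M : Matrix T T ℝ) : Prop :=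
  ∀ i j : T, {x : Γ | t x = j ∧
    ¬ (({y | y ∈ successors S x ∧ t y = i}.ncard : ℕ) : ℝ) = M i j}.Finite

/-! ### The matrices attached to a type system -/

/-- The number `p_j = |S| - ∑_i M_{ij}` of predecessors of a point of type `j`. -/
noncomputable def predCount {Γ T : Type*} [Fintype T] (S : Finset Γ) (M : Matrix T T ℝ) (j : T) :
    ℝ :=
  (S.card : ℝ) - ∑ i, M i j

/-- The matrix with entries `M_{ij} / p_i`. -/
noncomputable def tildeMatrix {Γ T : Type*} [Fintype T] (S : Finset Γ) (M : Matrix T T ℝ) :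
    Matrix T T ℝ :=
  Matrix.of fun i j => M i j / predCount S M i

/-- `r` is the dominating eigenvalue of the real matrix `B`: it is an eigenvalue, and every complex
eigenvalue has modulus at most `r`. -/
def IsDominatingEigenvalue {T : Type*} [Fintype T] [DecidableEq T] (B : Matrix T T ℝ) (r : ℝ) :
    Prop :=
  Module.End.HasEigenvalue (Matrix.toLin' B) r ∧
    ∀ μ : ℂ, Module.End.HasEigenvalue (Matrix.toLin' (B.map (fun a : ℝ => (a : ℂ)))) μ → ‖μ‖ ≤ r

/-- The matrix `D^{-1/2} M D^{1/2}`, where `D` is the diagonal matrix with entries `A_i`. -/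
noncomputable def primeMatrix {T : Type*} [Fintype T] [DecidableEq T] (A : T → ℝ)
    (M : Matrix T T ℝ) : Matrix T T ℝ :=
  Matrix.diagonal (fun i => (Real.sqrt (A i))⁻¹) * M * Matrix.diagonal (fun i => Real.sqrt (A i))

/-- The values `⟨B q, q⟩` of the quadratic form of `B` on the Euclidean unit sphere. -/
def sphereValues {T : Type*} [Fintype T] (B : Matrix T T ℝ) : Set ℝ :=
  {r | ∃ q : T → ℝ, ∑ i, q i ^ 2 = 1 ∧ r = ∑ i, (B.mulVec q) i * q i}

/-- The random walk on `Y = ℤ × T`: it goes from `(n, j)` to `(n + 1, i)` with probability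
`M_{ij} / |S|`, and from `(n, j)` to `(n - 1, i)` with probability
`e^{-v} A_i M_{ji} / (A_j |S|)`. -/
noncomputable def walkY {Γ T : Type*} (S : Finset Γ) (M : Matrix T T ℝ) (v : ℝ) (A : T → ℝ)
    (x y : ℤ × T) : ℝ :=
  if y.1 = x.1 + 1 then M y.2 x.2 / (S.card : ℝ)
  else if y.1 = x.1 - 1 then Real.exp (-v) * (A y.2 * M x.2 y.2 / (A x.2 * (S.card : ℝ)))
  else 0

/-!
The random walk on `ℤ × T` is reversible with respect to the measure `(k, j) ↦ e^{vk} A_j`. Write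
`q = D^{1/2} g` for a maximizer of `⟨M' q, q⟩` on the unit sphere. It may be taken nonnegative, and it
is then positive since `M` is primitive (`exists_pos_typeForm_eq`). That `q` is a critical point
says that `(k, j) ↦ e^{-vk/2} g_j` is a positive eigenfunction of the walk, for the eigenvalue
`r = 2 e^{-v/2} λ / |S|` (`walkY_eigen`). Positivity gives the bound `r ^ 2n` for the return
probabilities at time `2n`. Conversely, by reversibility these are weighted `ℓ²` norms of the
distribution at time `n`, which lives on `(2n + 1) |T|` points, and the Cauchy–Schwarz inequality
bounds them from below by a multiple of `r ^ 2n / (2n + 1)`. Hence the spectral radius is `r`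
(`hasSpectralRadius_walkY`).

On the group, the return probabilities at even times are supermultiplicative, so the spectral radius
`ρ` of the simple random walk exists. It bounds the Rayleigh quotients `⟨Pf, f⟩ / ⟨f, f⟩` of finitely
supported nonnegative functions, because `⟨Pⁿ f, f⟩² ≤ ⟨f, f⟩ ⟨P²ⁿ f, f⟩`
(`HasSpectralRadius.rayleigh_le`).

Assume that the group is infinite. The Cayley graph being bipartite, all but finitely many points of
type `i` have exactly `p_i` predecessors, and counting the edges between consecutive spheres from
both sides shows that the vectors `N_n` which count the points of each type on the sphere of radius
`n` satisfy `N_{n+1} = M̃ N_n` for large `n` (`sum_mul_sphereCount`). By primitivity the averages of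
`e^{-vn} N_n` accumulate at a positive multiple of `A` (`exists_average_tendsto`). So the Rayleigh
quotients of `x ↦ e^{-v|x|/2} g_{t(x)}`, restricted to long ranges of radii `|x|`, come arbitrarily
close to `2 e^{-v/2} / |S| * ⟨M' q, q⟩ / ⟨q, q⟩ = r`, and `ρ ≥ r` (`HasSpectralRadius.le_of_infinite`).

If the group is finite, the type system carries no information, but constant functions give `ρ ≥ 1`,
while `r ≤ 1` as for every Markov chain.
-/

/-! ### Chains with finite range -/

section Kernel

variable {X : Type*} {p : X → X → ℝ}

/-- Only finitely many transitions out of each point are possible, so that all the sums defining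
`nStep` are finite sums. -/
def FiniteRange (p : X → X → ℝ) : Prop := ∀ x, (Function.support (p x)).Finite

lemma FiniteRange.summable_mul (hp : FiniteRange p) (x : X) (f : X → ℝ) :
    Summable fun z => p x z * f z :=
  summable_of_hasFiniteSupport ((hp x).subset fun _ hz => left_ne_zero_of_mul hz)

lemma FiniteRange.iterate (hp : FiniteRange p) (n : ℕ) : FiniteRange (nStep p n) := by
  induction n with
  | zero =>
    intro x
    refine (Set.finite_singleton x).subset fun y hy => ?_
    by_contra h
    exact hy (if_neg fun h' => h h'.symm)
  | succ n ih =>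
    intro x
    refine ((hp x).biUnion fun z _ => ih z).subset fun y hy => ?_
    by_contra h
    simp only [Set.mem_iUnion, Function.mem_support, not_exists] at h
    refine hy ((tsum_congr fun z => ?_).trans tsum_zero)
    by_cases hz : p x z = 0
    · rw [hz, zero_mul]
    · rw [not_not.1 (h z hz), mul_zero]

lemma nStep_one (x y : X) : nStep p 1 x y = p x y := by
  classical
  change ∑' z, p x z * (if z = y then 1 else 0) = p x y
  rw [tsum_eq_single y fun z hz => by simp [hz]]
  simp

/-- The value at `x` of the function obtained by applying the `n`-step operator to `f` can be
computed by making the first step separately. -/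
lemma FiniteRange.tsum_nStep_succ (hp : FiniteRange p) (n : ℕ) (x : X) (f : X → ℝ) :
    ∑' y, nStep p (n + 1) x y * f y =
      ∑' z, p x z * ∑' y, nStep p n z y * f y := by
  have h1 : ∀ y, nStep p (n + 1) x y =
      ∑ z ∈ (hp x).toFinset, p x z * nStep p n z y := fun y =>
    tsum_eq_sum fun z hz => by
      rw [Set.Finite.mem_toFinset, Function.notMem_support] at hz
      rw [hz, zero_mul]
  have h2 : ∑' z, p x z * ∑' y, nStep p n z y * f y =
      ∑ z ∈ (hp x).toFinset, p x z * ∑' y, nStep p n z y * f y :=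
    tsum_eq_sum fun z hz => by
      rw [Set.Finite.mem_toFinset, Function.notMem_support] at hz
      rw [hz, zero_mul]
  rw [h2]
  simp_rw [h1, Finset.sum_mul, mul_assoc]
  rw [Summable.tsum_finsetSum fun z _ => ((hp.iterate n).summable_mul z f).mul_left (p x z)]
  simp_rw [tsum_mul_left]

lemma tsum_nStep_zero (x : X) (f : X → ℝ) : ∑' y, nStep p 0 x y * f y = f x := by
  classical
  change ∑' y, (if x = y then 1 else 0) * f y = f x
  rw [tsum_eq_single x fun z hz => by simp [hz.symm]]
  simp

/-- The Chapman–Kolmogorov equation. -/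
lemma FiniteRange.nStep_add (hp : FiniteRange p) (m n : ℕ) (x y : X) :
    nStep p (m + n) x y = ∑' z, nStep p m x z * nStep p n z y := by
  induction m generalizing x with
  | zero => rw [tsum_nStep_zero, zero_add]
  | succ m ih =>
    rw [hp.tsum_nStep_succ, Nat.succ_add]
    exact tsum_congr fun z => by rw [ih]

lemma nStep_nonneg (h0 : ∀ x y, 0 ≤ p x y) (n : ℕ) (x y : X) : 0 ≤ nStep p n x y := by
  induction n generalizing x with
  | zero => unfold nStep; split_ifs <;> norm_num
  | succ n ih => exact tsum_nonneg fun z => mul_nonneg (h0 x z) (ih z)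

/-- An eigenfunction of the transition operator is an eigenfunction of its iterates. -/
lemma FiniteRange.tsum_nStep_of_eigen (hp : FiniteRange p) {f : X → ℝ} {r : ℝ}
    (hf : ∀ x, ∑' z, p x z * f z = r * f x) (n : ℕ) (x : X) :
    ∑' y, nStep p n x y * f y = r ^ n * f x := by
  induction n generalizing x with
  | zero => rw [tsum_nStep_zero, pow_zero, one_mul]
  | succ n ih =>
    rw [hp.tsum_nStep_succ]
    simp_rw [ih, mul_left_comm _ (r ^ n), tsum_mul_left, hf]
    ring

lemma FiniteRange.nStep_mul_le_of_eigen (hp : FiniteRange p) (h0 : ∀ x y, 0 ≤ p x y)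
    {f : X → ℝ} (f0 : ∀ x, 0 ≤ f x) {r : ℝ}
    (hf : ∀ x, ∑' z, p x z * f z = r * f x) (n : ℕ) (x y : X) :
    nStep p n x y * f y ≤ r ^ n * f x := by
  rw [← hp.tsum_nStep_of_eigen hf]
  exact ((hp.iterate n).summable_mul x f).le_tsum y
    fun z _ => mul_nonneg (nStep_nonneg h0 n x z) (f0 z)

lemma FiniteRange.nStep_reversible (hp : FiniteRange p) {m : X → ℝ}
    (hm : ∀ x y, m x * p x y = m y * p y x) (n : ℕ) (x y : X) :
    m x * nStep p n x y = m y * nStep p n y x := by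
  classical
  induction n generalizing x y with
  | zero =>
    change m x * (if x = y then 1 else 0) = m y * (if y = x then 1 else 0)
    by_cases h : x = y
    · simp [h]
    · simp [h, Ne.symm h]
  | succ n ih =>
    rw [hp.nStep_add n 1 y x]
    change m x * ∑' z, _ = _
    rw [← tsum_mul_left, ← tsum_mul_left]
    refine tsum_congr fun z => ?_
    rw [nStep_one, ← mul_assoc, hm, mul_right_comm, ih]
    ring

/-- For a chain which is reversible with respect to `m`, the return probabilities at even times
are weighted `ℓ²` norms. -/
lemma FiniteRange.nStep_two_mul_self (hp : FiniteRange p) {m : X → ℝ} (m0 : ∀ x, 0 < m x)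
    (hm : ∀ x y, m x * p x y = m y * p y x) (n : ℕ) (x : X) :
    nStep p (2 * n) x x = ∑' y, nStep p n x y * (m x / m y * nStep p n x y) := by
  rw [two_mul, hp.nStep_add]
  refine tsum_congr fun y => ?_
  congr 1
  rw [div_mul_eq_mul_div, hp.nStep_reversible hm, mul_div_cancel_left₀ _ (m0 y).ne']

/-- Lower bound for the return probabilities of a reversible chain in terms of an eigenfunction,
by the Cauchy–Schwarz inequality on the set of points which can be reached in `n` steps. -/
lemma FiniteRange.le_nStep_two_mul (hp : FiniteRange p) {m : X → ℝ} (m0 : ∀ x, 0 < m x)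
    (hm : ∀ x y, m x * p x y = m y * p y x) {f : X → ℝ} {r : ℝ}
    (hf : ∀ x, ∑' z, p x z * f z = r * f x) {n : ℕ} {x : X} {F : Finset X}
    (hF : ∀ y, nStep p n x y ≠ 0 → y ∈ F) {C : ℝ} (hC : ∀ y, m y * f y ^ 2 ≤ C) :
    (r ^ n) ^ 2 * (m x * f x ^ 2) ≤ (F.card * C) * nStep p (2 * n) x x := by
  have h1 : r ^ n * f x = ∑ y ∈ F, nStep p n x y * f y := by
    rw [← hp.tsum_nStep_of_eigen hf]
    refine tsum_eq_sum fun y hy => ?_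
    rw [not_not.1 fun h => hy (hF y h), zero_mul]
  have h2 : nStep p (2 * n) x x = ∑ y ∈ F, m x * (nStep p n x y ^ 2 / m y) := by
    rw [hp.nStep_two_mul_self m0 hm, tsum_eq_sum (s := F) fun y hy => by
      rw [not_not.1 fun h => hy (hF y h), zero_mul]]
    exact Finset.sum_congr rfl fun y _ => by ring
  have h3 : (r ^ n * f x) ^ 2 ≤
      (∑ y ∈ F, nStep p n x y ^ 2 / m y) * ∑ y ∈ F, m y * f y ^ 2 := by
    rw [h1]
    refine Finset.sum_sq_le_sum_mul_sum_of_sq_le_mul F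
      (fun y _ => div_nonneg (sq_nonneg _) (m0 y).le)
      (fun y _ => mul_nonneg (m0 y).le (sq_nonneg _)) fun y _ => ?_
    have := (m0 y).ne'
    refine le_of_eq ?_
    field_simp
  have h4 : ∑ y ∈ F, m y * f y ^ 2 ≤ F.card * C := by
    simpa using Finset.sum_le_card_nsmul F _ C fun y _ => hC y
  rw [h2, ← Finset.mul_sum]
  calc (r ^ n) ^ 2 * (m x * f x ^ 2) = m x * (r ^ n * f x) ^ 2 := by ring
    _ ≤ m x * ((∑ y ∈ F, nStep p n x y ^ 2 / m y) * (F.card * C)) := by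
      refine mul_le_mul_of_nonneg_left (h3.trans (mul_le_mul_of_nonneg_left h4 ?_)) (m0 x).le
      exact Finset.sum_nonneg fun y _ => div_nonneg (sq_nonneg _) (m0 y).le
    _ = _ := by ring

end Kernel

/-! ### Roots of sequences of exponential growth -/

lemma tendsto_const_rpow_one_div_two_mul {c : ℝ} (hc : 0 < c) :
    Tendsto (fun n : ℕ => c ^ (1 / (2 * (n : ℝ)))) atTop (𝓝 1) := by
  have h : Tendsto (fun n : ℕ => 1 / (2 * (n : ℝ))) atTop (𝓝 0) :=
    tendsto_const_nhds.div_atTop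
      (tendsto_natCast_atTop_atTop.const_mul_atTop (by norm_num : (0 : ℝ) < 2))
  simpa only [Real.rpow_zero, Function.comp_def] using
    (Real.continuousAt_const_rpow hc.ne').tendsto.comp h

lemma tendsto_root_of_bounds {a : ℕ → ℝ} {r c : ℝ} (hr : 0 ≤ r) (hc : 0 < c)
    (hlow : ∀ n : ℕ, c / (2 * n + 1) * r ^ (2 * n) ≤ a n) (hup : ∀ n, a n ≤ r ^ (2 * n)) :
    Tendsto (fun n : ℕ => a n ^ (1 / (2 * (n : ℝ)))) atTop (𝓝 r) := by
  have hroot : ∀ n : ℕ, 1 ≤ n → (r ^ (2 * n)) ^ (1 / (2 * (n : ℝ))) = r := fun n hn => by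
    have := Real.pow_rpow_inv_natCast hr (n := 2 * n) (by omega)
    simpa using this
  have h2 : Tendsto (fun n : ℕ => (2 * (n : ℝ) + 1) ^ (1 / (2 * (n : ℝ)))) atTop (𝓝 1) := by
    have h := tendsto_rpow_div_mul_add 1 1 (-1) zero_ne_one
    have h' : Tendsto (fun n : ℕ => 2 * (n : ℝ) + 1) atTop atTop :=
      tendsto_atTop_add_const_right _ _
        (tendsto_natCast_atTop_atTop.const_mul_atTop (by norm_num : (0 : ℝ) < 2))
    refine (h.comp h').congr fun n => ?_
    simp
  have h3 : Tendsto (fun n : ℕ => c ^ (1 / (2 * (n : ℝ))) /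
      (2 * (n : ℝ) + 1) ^ (1 / (2 * (n : ℝ))) * r) atTop (𝓝 r) := by
    simpa using ((tendsto_const_rpow_one_div_two_mul hc).div h2 one_ne_zero).mul_const r
  have hpos : ∀ n : ℕ, (0 : ℝ) < 2 * n + 1 := fun n => by positivity
  refine tendsto_of_tendsto_of_tendsto_of_le_of_le' h3 tendsto_const_nhds ?_ ?_
  · filter_upwards [eventually_ge_atTop 1] with n hn
    have h := Real.rpow_le_rpow (z := 1 / (2 * (n : ℝ)))
      (mul_nonneg (div_nonneg hc.le (hpos n).le) (pow_nonneg hr _)) (hlow n) (by positivity)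
    rwa [Real.mul_rpow (div_nonneg hc.le (hpos n).le) (pow_nonneg hr _), hroot n hn,
      Real.div_rpow hc.le (hpos n).le] at h
  · filter_upwards [eventually_ge_atTop 1] with n hn
    have h := Real.rpow_le_rpow (z := 1 / (2 * (n : ℝ)))
      ((mul_nonneg (div_nonneg hc.le (hpos n).le) (pow_nonneg hr _)).trans (hlow n)) (hup n)
      (by positivity)
    rwa [hroot n hn] at h

/-! ### Rayleigh quotients of symmetric chains -/

section Rayleigh

variable {X : Type*} {p : X → X → ℝ}

/-- The value `⟨Pⁿ f, f⟩`, for the function which is `f` on `F` and zero elsewhere. -/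
noncomputable def quadStep (p : X → X → ℝ) (F : Finset X) (f : X → ℝ) (n : ℕ) : ℝ :=
  ∑ x ∈ F, ∑ y ∈ F, f x * f y * nStep p n x y

lemma quadStep_zero (F : Finset X) (f : X → ℝ) : quadStep p F f 0 = ∑ x ∈ F, f x ^ 2 := by
  classical
  refine Finset.sum_congr rfl fun x hx => ?_
  simp only [nStep]
  rw [Finset.sum_eq_single x (fun y _ hy => by simp [hy.symm]) (fun h => absurd hx h)]
  simp [pow_two]

lemma quadStep_one (F : Finset X) (f : X → ℝ) :
    quadStep p F f 1 = ∑ x ∈ F, ∑ y ∈ F, f x * f y * p x y := by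
  simp_rw [quadStep, nStep_one]

lemma FiniteRange.nStep_symm (hp : FiniteRange p) (hs : ∀ x y, p x y = p y x) (n : ℕ) (x y : X) :
    nStep p n x y = nStep p n y x := by
  simpa using hp.nStep_reversible (m := fun _ => 1) (by simpa using hs) n x y

/-- `⟨Pⁿ f, f⟩² ≤ ⟨f, f⟩ ⟨P²ⁿ f, f⟩`: the Cauchy–Schwarz inequality for `Pⁿ f` and `f`. -/
lemma FiniteRange.quadStep_sq_le (hp : FiniteRange p) (hs : ∀ x y, p x y = p y x) (F : Finset X)
    (f : X → ℝ) (n : ℕ) :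
    quadStep p F f n ^ 2 ≤ quadStep p F f 0 * quadStep p F f (2 * n) := by
  set g : X → ℝ := fun z => ∑ x ∈ F, f x * nStep p n x z with hg
  have h1 : quadStep p F f n = ∑ z ∈ F, f z * g z := by
    rw [quadStep, Finset.sum_comm]
    refine Finset.sum_congr rfl fun z _ => ?_
    rw [hg, Finset.mul_sum]
    exact Finset.sum_congr rfl fun x _ => by ring
  have hsum : ∀ x y, Summable fun z => nStep p n x z * nStep p n z y := fun x y =>
    (hp.iterate n).summable_mul x _
  have h2 : quadStep p F f (2 * n) = ∑' z, g z ^ 2 := by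
    have h3 : ∀ z, g z ^ 2 =
        ∑ x ∈ F, ∑ y ∈ F, f x * f y * (nStep p n x z * nStep p n z y) := fun z => by
      rw [hg, pow_two, Finset.sum_mul_sum]
      refine Finset.sum_congr rfl fun x _ => Finset.sum_congr rfl fun y _ => ?_
      rw [hp.nStep_symm hs n z y]
      ring
    simp_rw [h3]
    rw [Summable.tsum_finsetSum fun x _ => summable_sum fun y _ => (hsum x y).mul_left _]
    refine Finset.sum_congr rfl fun x _ => ?_
    rw [Summable.tsum_finsetSum fun y _ => (hsum x y).mul_left _]
    refine Finset.sum_congr rfl fun y _ => ?_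
    rw [tsum_mul_left, two_mul, hp.nStep_add]
  have h4 : ∑ z ∈ F, g z ^ 2 ≤ quadStep p F f (2 * n) := by
    rw [h2]
    refine Summable.sum_le_tsum F (fun z _ => sq_nonneg _) ?_
    refine summable_of_hasFiniteSupport ?_
    refine (Set.Finite.biUnion F.finite_toSet fun x _ => hp.iterate n x).subset fun z hz => ?_
    by_contra h
    simp only [Set.mem_iUnion, Function.mem_support, not_exists, not_not] at h
    refine hz ?_
    simp only [hg]
    rw [Finset.sum_eq_zero fun x hx => by rw [h x hx, mul_zero]]
    simp
  rw [quadStep_zero, h1]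
  exact (Finset.sum_mul_sq_le_sq_mul_sq F f g).trans
    (mul_le_mul_of_nonneg_left h4 (Finset.sum_nonneg fun _ _ => sq_nonneg _))

/-- If the `2n`-step probabilities of a symmetric chain are bounded by a sequence with exponential
growth rate `ρ`, then the Rayleigh quotients of finitely supported functions are at most `ρ`:
iterating `FiniteRange.quadStep_sq_le` along powers of two bounds `(⟨Pf, f⟩ / ⟨f, f⟩) ^ 2n` by a
constant multiple of the `2n`-step probabilities. -/
lemma FiniteRange.rayleigh_le (hp : FiniteRange p) (h0 : ∀ x y, 0 ≤ p x y)
    (hs : ∀ x y, p x y = p y x) {a : ℕ → ℝ} (ha : ∀ n x y, nStep p (2 * n) x y ≤ a n) {ρ : ℝ}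
    (hρ : Tendsto (fun n : ℕ => a n ^ (1 / (2 * (n : ℝ)))) atTop (𝓝 ρ))
    (F : Finset X) {f : X → ℝ} (f0 : ∀ x, 0 ≤ f x) :
    ∑ x ∈ F, ∑ y ∈ F, f x * f y * p x y ≤ ρ * ∑ x ∈ F, f x ^ 2 := by
  set s := quadStep p F f with hsdef
  rw [← quadStep_one, ← quadStep_zero (p := p), ← hsdef]
  have snn : ∀ n, 0 ≤ s n := fun n => Finset.sum_nonneg fun x _ => Finset.sum_nonneg fun y _ =>
    mul_nonneg (mul_nonneg (f0 x) (f0 y)) (nStep_nonneg h0 n x y)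
  have hsq : ∀ n, s n ^ 2 ≤ s 0 * s (2 * n) := hp.quadStep_sq_le hs F f
  rcases (snn 0).eq_or_lt with h | hpos
  · have := hsq 1
    rw [← h] at this ⊢
    nlinarith
  set q := s 1 / s 0 with hq
  have q0 : 0 ≤ q := div_nonneg (snn 1) (snn 0)
  have hpow : ∀ k, q ^ 2 ^ k ≤ s (2 ^ k) / s 0 := fun k => by
    induction k with
    | zero => simp [hq]
    | succ k ih =>
      rw [pow_succ, pow_mul]
      refine (pow_le_pow_left₀ (pow_nonneg q0 _) ih 2).trans ?_
      rw [div_pow, div_le_div_iff₀ (by positivity) hpos, mul_comm _ 2]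
      nlinarith [hsq (2 ^ k)]
  set C := (∑ x ∈ F, f x) ^ 2 / s 0 with hC
  have hbd : ∀ n, s (2 * n) / s 0 ≤ C * a n := fun n => by
    rw [hC, div_mul_eq_mul_div]
    refine div_le_div_of_nonneg_right ?_ hpos.le
    rw [pow_two, Finset.sum_mul_sum, Finset.sum_mul]
    refine Finset.sum_le_sum fun x _ => ?_
    rw [Finset.sum_mul]
    exact Finset.sum_le_sum fun y _ =>
      mul_le_mul_of_nonneg_left (ha n x y) (mul_nonneg (f0 x) (f0 y))
  have hCpos : 0 < C := by
    refine div_pos (pow_pos ((Finset.sum_nonneg fun x _ => f0 x).lt_of_ne fun h => ?_) 2) hpos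
    have h' := (Finset.sum_eq_zero_iff_of_nonneg fun x _ => f0 x).1 h.symm
    refine hpos.ne' ?_
    rw [hsdef, quadStep_zero]
    exact Finset.sum_eq_zero fun x hx => by rw [h' x hx]; norm_num
  have a0 : ∀ n, 0 ≤ a n := fun n => by
    obtain ⟨x, -⟩ : F.Nonempty := by
      rw [Finset.nonempty_iff_ne_empty]
      rintro rfl
      simp [hsdef, quadStep_zero] at hpos
    exact (nStep_nonneg h0 _ x x).trans (ha n x x)
  have hlim := ((tendsto_const_rpow_one_div_two_mul hCpos).mul hρ).comp
    (tendsto_pow_atTop_atTop_of_one_lt (r := 2) one_lt_two)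
  rw [one_mul] at hlim
  have hqρ : q ≤ ρ := by
    refine ge_of_tendsto' hlim fun k => ?_
    have h2k : (2 : ℕ) * 2 ^ k = 2 ^ (k + 1) := by ring
    have h := (hpow (k + 1)).trans (h2k ▸ hbd (2 ^ k))
    have h' := Real.rpow_le_rpow (z := 1 / (2 * ((2 ^ k : ℕ) : ℝ))) (pow_nonneg q0 _) h
      (by positivity)
    rw [Real.mul_rpow hCpos.le (a0 _), ← h2k] at h'
    have hroot := Real.pow_rpow_inv_natCast q0 (n := 2 * 2 ^ k) (by positivity)
    rw [Nat.cast_mul, Nat.cast_ofNat, ← one_div] at hroot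
    rwa [hroot] at h'
  calc s 1 = q * s 0 := (div_mul_cancel₀ _ hpos.ne').symm
    _ ≤ ρ * s 0 := mul_le_mul_of_nonneg_right hqρ hpos.le

end Rayleigh

/-! ### The simple random walk on a group -/

section SimpleRandomWalk

variable {Γ : Type*} [Group Γ] {S : Finset Γ}

lemma simpleRandomWalk_nonneg (x y : Γ) : 0 ≤ simpleRandomWalk S x y := by
  unfold simpleRandomWalk
  split_ifs <;> positivity

lemma simpleRandomWalk_symm (hS : ∀ s ∈ S, s⁻¹ ∈ S) (x y : Γ) :
    simpleRandomWalk S x y = simpleRandomWalk S y x := by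
  have h : x⁻¹ * y ∈ S ↔ y⁻¹ * x ∈ S :=
    ⟨fun h => by simpa using hS _ h, fun h => by simpa using hS _ h⟩
  unfold simpleRandomWalk
  congr 1
  exact propext h

lemma finiteRange_simpleRandomWalk (S : Finset Γ) : FiniteRange (simpleRandomWalk S) := by
  intro x
  refine (S.finite_toSet.image (x * ·)).subset fun y hy => ?_
  refine ⟨x⁻¹ * y, ?_, by simp⟩
  by_contra h
  exact hy (if_neg h)

lemma tsum_simpleRandomWalk_mul (x : Γ) (f : Γ → ℝ) :
    ∑' y, simpleRandomWalk S x y * f y = (∑ s ∈ S, f (x * s)) / S.card := by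
  classical
  rw [tsum_eq_sum (s := S.image (x * ·)) fun y hy => ?_]
  · rw [Finset.sum_image fun a _ b _ h => mul_left_cancel h, Finset.sum_div]
    refine Finset.sum_congr rfl fun s hs => ?_
    simp [simpleRandomWalk, hs, div_eq_inv_mul]
  · rw [simpleRandomWalk, if_neg fun h => hy (Finset.mem_image.2 ⟨_, h, by simp⟩), zero_mul]

lemma nStep_simpleRandomWalk_mul_left (n : ℕ) (g x y : Γ) :
    nStep (simpleRandomWalk S) n (g * x) (g * y) = nStep (simpleRandomWalk S) n x y := by
  induction n generalizing x with
  | zero =>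
    unfold nStep
    congr 1
    exact propext (mul_right_inj g)
  | succ n ih =>
    change ∑' z, _ = ∑' z, _
    rw [← (Equiv.mulLeft g).tsum_eq]
    refine tsum_congr fun z => ?_
    rw [Equiv.coe_mulLeft, ih]
    congr 1
    unfold simpleRandomWalk
    congr 1
    simp [mul_assoc]

lemma nStep_simpleRandomWalk_self (n : ℕ) (x : Γ) :
    nStep (simpleRandomWalk S) n x x = nStep (simpleRandomWalk S) n 1 1 := by
  simpa using nStep_simpleRandomWalk_mul_left (S := S) n x 1 1

/-- A return is the most likely outcome of an even number of steps. -/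
lemma nStep_simpleRandomWalk_le (hS : ∀ s ∈ S, s⁻¹ ∈ S) (n : ℕ) (x y : Γ) :
    nStep (simpleRandomWalk S) (2 * n) x y ≤ nStep (simpleRandomWalk S) (2 * n) 1 1 := by
  have hp := finiteRange_simpleRandomWalk S
  set P := nStep (simpleRandomWalk S) n with hP
  have hsym := hp.nStep_symm (simpleRandomWalk_symm hS) n
  have hsq : ∀ x, HasSum (fun z => P x z * P x z) (nStep (simpleRandomWalk S) (2 * n) 1 1) := by
    intro x
    rw [← nStep_simpleRandomWalk_self (2 * n) x, two_mul, hp.nStep_add]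
    simp_rw [hsym _ x]
    exact ((hp.iterate n).summable_mul x _).hasSum
  rw [two_mul, hp.nStep_add, ← two_mul]
  simp_rw [hsym _ y]
  have h := ((hsq x).add (hsq y)).div_const 2
  rw [add_self_div_two] at h
  rw [← h.tsum_eq]
  refine Summable.tsum_le_tsum (fun z => ?_) ((hp.iterate n).summable_mul x _) h.summable
  nlinarith [sq_nonneg (P x z - P y z)]

lemma nStep_simpleRandomWalk_le_one (hne : S.Nonempty) (n : ℕ) (x y : Γ) :
    nStep (simpleRandomWalk S) n x y ≤ 1 := by
  have hc : (S.card : ℝ) ≠ 0 := by exact_mod_cast hne.card_pos.ne'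
  simpa using (finiteRange_simpleRandomWalk S).nStep_mul_le_of_eigen simpleRandomWalk_nonneg
    (f := fun _ => 1) (fun _ => zero_le_one) (r := 1)
    (fun x => by rw [tsum_simpleRandomWalk_mul]; simp [hc]) n x y

/-- The spectral radius of the simple random walk exists, by Fekete's lemma: the return
probabilities at even times are supermultiplicative. -/
lemma exists_hasSpectralRadius_simpleRandomWalk (hS : ∀ s ∈ S, s⁻¹ ∈ S) (hne : S.Nonempty) :
    ∃ ρ, HasSpectralRadius (simpleRandomWalk S) ρ := by
  have hp := finiteRange_simpleRandomWalk S
  set a : ℕ → ℝ := fun n => nStep (simpleRandomWalk S) (2 * n) 1 1 with ha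
  have nn := nStep_nonneg (simpleRandomWalk_nonneg (S := S))
  have hmul : ∀ m n, a m * a n ≤ a (m + n) := fun m n => by
    simp only [ha]
    rw [mul_add, hp.nStep_add]
    exact ((hp.iterate (2 * m)).summable_mul 1 fun z => nStep _ (2 * n) z 1).le_tsum 1
      fun z _ => mul_nonneg (nn _ _ _) (nn _ _ _)
  have a1 : 0 < a 1 := by
    have hc : (0 : ℝ) < S.card := by exact_mod_cast hne.card_pos
    obtain ⟨s, hs⟩ := hne
    have h := ((hp.iterate 1).summable_mul 1 _).le_tsum s
      fun z _ => mul_nonneg (nn 1 1 z) (nn 1 z 1)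
    rw [← hp.nStep_add, nStep_one, nStep_one] at h
    refine lt_of_lt_of_le ?_ h
    simp only [simpleRandomWalk, inv_one, one_mul, mul_one, hs, hS s hs, if_true]
    positivity
  have apos : ∀ n, 0 < a n := fun n => by
    induction n with
    | zero => simp [ha, nStep]
    | succ n ih => exact (mul_pos ih a1).trans_le (hmul n 1)
  have hsub : Subadditive fun n => -Real.log (a n) := fun m n => by
    rw [← neg_add, neg_le_neg_iff, ← Real.log_mul (apos m).ne' (apos n).ne']
    exact Real.log_le_log (mul_pos (apos m) (apos n)) (hmul m n)
  have hbdd : BddBelow (Set.range fun n : ℕ => -Real.log (a n) / n) := by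
    refine ⟨0, ?_⟩
    rintro _ ⟨n, rfl⟩
    have := Real.log_nonpos (apos n).le (nStep_simpleRandomWalk_le_one hne (2 * n) 1 1)
    exact div_nonneg (by linarith) n.cast_nonneg
  refine ⟨Real.exp (-hsub.lim / 2), fun x => ?_⟩
  refine ((Real.continuous_exp.tendsto _).comp
    ((hsub.tendsto_lim hbdd).neg.div_const 2)).congr fun n => ?_
  rw [nStep_simpleRandomWalk_self, Function.comp_apply, Real.rpow_def_of_pos (apos n)]
  congr 1
  ring

/-- Rayleigh quotients of finitely supported functions on the group bound the spectral radius of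
the simple random walk from below. -/
lemma HasSpectralRadius.rayleigh_le (hS : ∀ s ∈ S, s⁻¹ ∈ S) {ρ : ℝ}
    (hρ : HasSpectralRadius (simpleRandomWalk S) ρ) (F : Finset Γ) {f : Γ → ℝ}
    (f0 : ∀ x, 0 ≤ f x) :
    ∑ x ∈ F, ∑ y ∈ F, f x * f y * simpleRandomWalk S x y ≤ ρ * ∑ x ∈ F, f x ^ 2 :=
  (finiteRange_simpleRandomWalk S).rayleigh_le simpleRandomWalk_nonneg
    (simpleRandomWalk_symm hS) (nStep_simpleRandomWalk_le hS) (hρ 1) F f0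

end SimpleRandomWalk

/-! ### The quadratic form of a type system -/

section QuadraticForm

variable {T : Type*} [Fintype T]

/-- The quadratic form `⟨M' q, q⟩` in the coordinates `g = D^{-1/2} q`. -/
noncomputable def typeForm (M : Matrix T T ℝ) (A g : T → ℝ) : ℝ :=
  ∑ i, ∑ j, M i j * A j * g i * g j

variable {M : Matrix T T ℝ} {A : T → ℝ} {lam : ℝ}

lemma primeMatrix_form_eq_typeForm [DecidableEq T] (hA : ∀ i, 0 < A i) (g : T → ℝ) :
    ∑ i, ((primeMatrix A M).mulVec fun i => √(A i) * g i) i * (√(A i) * g i) =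
      typeForm M A g := by
  refine Finset.sum_congr rfl fun i _ => ?_
  rw [Matrix.mulVec, dotProduct, Finset.sum_mul]
  refine Finset.sum_congr rfl fun j _ => ?_
  rw [primeMatrix, Matrix.mul_diagonal, Matrix.diagonal_mul]
  have h := (Real.sqrt_pos.2 (hA i)).ne'
  have hj := Real.mul_self_sqrt (hA j).le
  calc (√(A i))⁻¹ * M i j * √(A j) * (√(A j) * g j) * (√(A i) * g i)
      = ((√(A i))⁻¹ * √(A i)) * M i j * (√(A j) * √(A j)) * g i * g j := by ring
    _ = _ := by rw [inv_mul_cancel₀ h, hj, one_mul]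

lemma sum_sq_sqrt_mul (hA : ∀ i, 0 < A i) (g : T → ℝ) :
    ∑ i, (√(A i) * g i) ^ 2 = ∑ i, A i * g i ^ 2 :=
  Finset.sum_congr rfl fun i _ => by rw [mul_pow, Real.sq_sqrt (hA i).le]

lemma typeForm_le [DecidableEq T] (hA : ∀ i, 0 < A i)
    (hlam : IsGreatest (sphereValues (primeMatrix A M)) lam) (g : T → ℝ) :
    typeForm M A g ≤ lam * ∑ i, A i * g i ^ 2 := by
  have hnn : ∀ i ∈ Finset.univ, 0 ≤ A i * g i ^ 2 := fun i _ => mul_nonneg (hA i).le (sq_nonneg _)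
  rcases (Finset.sum_nonneg hnn).eq_or_lt with h | h
  · have hg : ∀ i, g i = 0 := fun i => by
      have := (Finset.sum_eq_zero_iff_of_nonneg hnn).1 h.symm i (Finset.mem_univ i)
      simpa [(hA i).ne'] using this
    simp [typeForm, hg]
  · set N := ∑ i, A i * g i ^ 2 with hN
    have hs : (√N)⁻¹ * (√N)⁻¹ = N⁻¹ := by rw [← mul_inv, Real.mul_self_sqrt h.le]
    have h1 := hlam.2 ⟨fun i => √(A i) * ((√N)⁻¹ * g i), ?_, rfl⟩
    · rw [primeMatrix_form_eq_typeForm hA] at h1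
      have h2 : typeForm M A (fun i => (√N)⁻¹ * g i) = N⁻¹ * typeForm M A g := by
        simp only [typeForm, Finset.mul_sum]
        refine Finset.sum_congr rfl fun i _ => Finset.sum_congr rfl fun j _ => ?_
        rw [← hs]
        ring
      rwa [h2, inv_mul_le_iff₀ h, mul_comm] at h1
    · rw [sum_sq_sqrt_mul hA]
      calc ∑ i, A i * ((√N)⁻¹ * g i) ^ 2 = N⁻¹ * N := by
            rw [hN, Finset.mul_sum, ← hN]
            refine Finset.sum_congr rfl fun i _ => ?_
            rw [← hs]
            ring
        _ = 1 := inv_mul_cancel₀ h.ne'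

lemma eq_zero_of_forall_mul_add_sq_mul_nonpos {b c : ℝ} (h : ∀ t : ℝ, t * b + t ^ 2 * c ≤ 0) :
    b = 0 := by
  by_contra hb
  have hc : 0 < |c| + 1 := by positivity
  -- For this `t` the quadratic term is smaller than the linear one.
  have h1 := h (b / (|c| + 1))
  have h2 : b / (|c| + 1) * b + (b / (|c| + 1)) ^ 2 * c =
      (b / (|c| + 1)) ^ 2 * (|c| + 1 + c) := by
    field_simp
  rw [h2] at h1
  have h3 : 0 < |c| + 1 + c := by linarith [neg_abs_le c]
  have : 0 < (b / (|c| + 1)) ^ 2 * (|c| + 1 + c) := by positivity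
  linarith

/-- A maximizer of the quadratic form is a critical point. -/
lemma typeForm_critical [DecidableEq T] (hle : ∀ g, typeForm M A g ≤ lam * ∑ i, A i * g i ^ 2)
    {g : T → ℝ} (hg : typeForm M A g = lam * ∑ i, A i * g i ^ 2) (k : T) :
    ∑ i, M i k * A k * g i + ∑ i, M k i * A i * g i = 2 * lam * (A k * g k) := by
  suffices h : ∑ i, M i k * A k * g i + ∑ i, M k i * A i * g i - 2 * lam * (A k * g k) = 0 by
    linarith
  refine eq_zero_of_forall_mul_add_sq_mul_nonpos (c := M k k * A k - lam * A k) fun t => ?_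
  set u : T → ℝ := fun i => if i = k then 1 else 0 with hu
  have h1 := hle fun i => g i + t * u i
  have h2 : typeForm M A (fun i => g i + t * u i) = typeForm M A g +
      t * (∑ i, M i k * A k * g i + ∑ i, M k i * A i * g i) + t ^ 2 * (M k k * A k) := by
    have e1 : ∑ i, M i k * A k * g i = ∑ i, ∑ j, M i j * A j * g i * u j := by simp [hu]
    have e2 : ∑ i, M k i * A i * g i = ∑ i, ∑ j, M i j * A j * u i * g j := by simp [hu]
    have e3 : M k k * A k = ∑ i, ∑ j, M i j * A j * u i * u j := by simp [hu]
    rw [e1, e2, e3]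
    simp only [typeForm, Finset.mul_sum, ← Finset.sum_add_distrib]
    exact Finset.sum_congr rfl fun i _ => Finset.sum_congr rfl fun j _ => by ring
  have h3 : ∑ i, A i * (g i + t * u i) ^ 2 =
      ∑ i, A i * g i ^ 2 + 2 * t * (A k * g k) + t ^ 2 * A k := by
    have e1 : A k * g k = ∑ i, A i * g i * u i := by simp [hu]
    have e2 : A k = ∑ i, A i * u i ^ 2 := by simp [hu]
    rw [e1, e2]
    simp only [Finset.mul_sum, ← Finset.sum_add_distrib]
    exact Finset.sum_congr rfl fun i _ => by ring
  rw [h2, h3, hg] at h1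
  linarith

/-- The maximum of the quadratic form is nonnegative, and it is attained at a vector with positive
entries. This is the Perron–Frobenius theorem for the symmetric part of `M'`: the absolute value of
a maximizer is a maximizer, hence an eigenvector, and it is positive by primitivity. -/
lemma exists_pos_typeForm_eq [DecidableEq T] (hPF : M.IsPrimitive) (hA : ∀ i, 0 < A i)
    (hlam : IsGreatest (sphereValues (primeMatrix A M)) lam) :
    0 ≤ lam ∧ ∃ g : T → ℝ, (∀ i, 0 < g i) ∧ typeForm M A g = lam * ∑ i, A i * g i ^ 2 := by
  obtain ⟨q, hq1, hq2⟩ := hlam.1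
  set g₀ : T → ℝ := fun i => (√(A i))⁻¹ * q i with hg₀
  have hq : q = fun i => √(A i) * g₀ i := by
    ext i
    rw [hg₀, mul_inv_cancel_left₀ (Real.sqrt_pos.2 (hA i)).ne']
  rw [hq, sum_sq_sqrt_mul hA] at hq1
  rw [hq, primeMatrix_form_eq_typeForm hA] at hq2
  set g : T → ℝ := fun i => |g₀ i| with hg
  have g0 : ∀ i, 0 ≤ g i := fun i => abs_nonneg _
  have hg1 : ∑ i, A i * g i ^ 2 = 1 := by simpa [hg] using hq1
  have hgQ : typeForm M A g = lam * ∑ i, A i * g i ^ 2 := by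
    refine le_antisymm (typeForm_le hA hlam g) ?_
    rw [hg1, mul_one, hq2]
    refine Finset.sum_le_sum fun i _ => Finset.sum_le_sum fun j _ => ?_
    rw [mul_assoc, mul_assoc _ (g i), ← abs_mul]
    exact mul_le_mul_of_nonneg_left (le_abs_self _) (mul_nonneg (hPF.nonneg i j) (hA j).le)
  have lam0 : 0 ≤ lam := by
    rw [hg1, mul_one] at hgQ
    rw [← hgQ]
    exact Finset.sum_nonneg fun i _ => Finset.sum_nonneg fun j _ =>
      mul_nonneg (mul_nonneg (mul_nonneg (hPF.nonneg i j) (hA j).le) (g0 i)) (g0 j)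
  refine ⟨lam0, g, ?_, hgQ⟩
  -- The eigenvector equation without the terms of the transposed matrix.
  have hstep : ∀ k, ∑ i, g i * M i k ≤ 2 * lam * g k := fun k => by
    have h1 := typeForm_critical (typeForm_le hA hlam) hgQ k
    have h2 : 0 ≤ ∑ i, M k i * A i * g i := Finset.sum_nonneg fun i _ =>
      mul_nonneg (mul_nonneg (hPF.nonneg k i) (hA i).le) (g0 i)
    have h3 : ∑ i, M i k * A k * g i = A k * ∑ i, g i * M i k := by
      rw [Finset.mul_sum]
      exact Finset.sum_congr rfl fun i _ => by ring
    refine le_of_mul_le_mul_left ?_ (hA k)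
    linarith
  have hpow : ∀ n k, ∑ i, g i * (M ^ n) i k ≤ (2 * lam) ^ n * g k := fun n => by
    induction n with
    | zero => intro k; simp [Matrix.one_apply]
    | succ n ih =>
      intro k
      calc ∑ i, g i * (M ^ (n + 1)) i k = ∑ j, (∑ i, g i * (M ^ n) i j) * M j k := by
            simp_rw [pow_succ, Matrix.mul_apply, Finset.mul_sum, Finset.sum_mul]
            rw [Finset.sum_comm]
            exact Finset.sum_congr rfl fun j _ => Finset.sum_congr rfl fun i _ => by ring
        _ ≤ ∑ j, ((2 * lam) ^ n * g j) * M j k :=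
            Finset.sum_le_sum fun j _ => mul_le_mul_of_nonneg_right (ih j) (hPF.nonneg j k)
        _ = (2 * lam) ^ n * ∑ j, g j * M j k := by
            rw [Finset.mul_sum]
            exact Finset.sum_congr rfl fun j _ => by ring
        _ ≤ (2 * lam) ^ n * (2 * lam * g k) :=
            mul_le_mul_of_nonneg_left (hstep k) (by positivity)
        _ = _ := by ring
  -- A power of `M` is positive, so no entry of `g` can vanish.
  obtain ⟨n, -, hn⟩ := hPF.exists_pos_pow
  obtain ⟨i, hi⟩ : ∃ i, 0 < g i := by
    by_contra! h
    have : ∀ i, g i = 0 := fun i => le_antisymm (h i) (g0 i)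
    simp [this] at hg1
  intro k
  have h1 : 0 < ∑ i, g i * (M ^ n) i k := Finset.sum_pos'
    (fun i _ => mul_nonneg (g0 i) (hn i k).le) ⟨i, Finset.mem_univ i, mul_pos hi (hn i k)⟩
  exact pos_of_mul_pos_right (h1.trans_le (hpow n k)) (by positivity)

end QuadraticForm

/-! ### The random walk on `ℤ × T` -/

section WalkY

variable {Γ T : Type*} {S : Finset Γ} {M : Matrix T T ℝ} {v : ℝ} {A : T → ℝ}

lemma walkY_nonneg (hM : ∀ i j, 0 ≤ M i j) (hA : ∀ i, 0 < A i) (x y : ℤ × T) :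
    0 ≤ walkY S M v A x y := by
  have h1 := hM y.2 x.2
  have h2 := hM x.2 y.2
  have h3 := (hA y.2).le
  have h4 := (hA x.2).le
  unfold walkY
  split_ifs <;> positivity

lemma level_of_walkY_ne_zero {x y : ℤ × T} (h : walkY S M v A x y ≠ 0) :
    y.1 = x.1 + 1 ∨ y.1 = x.1 - 1 := by
  contrapose! h
  rw [walkY, if_neg h.1, if_neg h.2]

/-- The walk on `ℤ × T` is reversible with respect to the measure `(k, j) ↦ e^{vk} A_j`. -/
lemma walkY_reversible (hA : ∀ i, 0 < A i) (x y : ℤ × T) :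
    Real.exp (v * x.1) * A x.2 * walkY S M v A x y =
      Real.exp (v * y.1) * A y.2 * walkY S M v A y x := by
  have key : ∀ x y : ℤ × T, y.1 = x.1 + 1 → Real.exp (v * x.1) * A x.2 * walkY S M v A x y =
      Real.exp (v * y.1) * A y.2 * walkY S M v A y x := fun x y h => by
    have h1 : x.1 ≠ y.1 + 1 := by omega
    have h2 : x.1 = y.1 - 1 := by omega
    rw [walkY, walkY, if_pos h, if_neg h1, if_pos h2, h]
    have e : Real.exp (v * ((x.1 + 1 : ℤ) : ℝ)) = Real.exp (v * x.1) * Real.exp v := by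
      rw [← Real.exp_add]
      push_cast
      ring_nf
    rw [e, Real.exp_neg]
    have := (hA y.2).ne'
    have := (Real.exp_pos v).ne'
    rcases eq_or_ne (S.card : ℝ) 0 with h0 | h0
    · simp [h0]
    · field_simp
  by_cases h : y.1 = x.1 + 1
  · exact key x y h
  by_cases h' : x.1 = y.1 + 1
  · exact (key y x h').symm
  rw [walkY, if_neg h, if_neg (by omega), walkY, if_neg h', if_neg (by omega)]
  simp

lemma level_of_nStep_walkY_ne_zero {n : ℕ} {x y : ℤ × T}
    (h : nStep (walkY S M v A) n x y ≠ 0) : y.1 ∈ Finset.Icc (x.1 - n) (x.1 + n) := by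
  induction n generalizing x with
  | zero =>
    have : x = y := by
      by_contra h'
      exact h (if_neg h')
    simp [this]
  | succ n ih =>
    obtain ⟨z, hz⟩ : ∃ z, walkY S M v A x z * nStep (walkY S M v A) n z y ≠ 0 := by
      by_contra! h'
      exact h ((tsum_congr h').trans tsum_zero)
    have h1 := level_of_walkY_ne_zero (left_ne_zero_of_mul hz)
    have h2 := ih (right_ne_zero_of_mul hz)
    simp only [Finset.mem_Icc] at h2 ⊢
    push_cast
    omega

variable [Fintype T]

lemma sum_mul_eq_of_tildeMatrix_mulVec
    (hAv : (tildeMatrix S M).mulVec A = Real.exp v • A) (i : T) :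
    (∑ j, M i j * A j) / predCount S M i = Real.exp v * A i := by
  have h := congrFun hAv i
  rw [Pi.smul_apply, smul_eq_mul] at h
  rw [← h, Matrix.mulVec, dotProduct, Finset.sum_div]
  exact Finset.sum_congr rfl fun j _ => by rw [tildeMatrix, Matrix.of_apply]; ring

/-- The numbers of predecessors are positive, because the row of `M̃` of a type without
predecessors would be nonpositive (with the convention `x / 0 = 0`). -/
lemma predCount_pos (hM : ∀ i j, 0 ≤ M i j) (hA : ∀ i, 0 < A i)
    (hAv : (tildeMatrix S M).mulVec A = Real.exp v • A) (i : T) : 0 < predCount S M i := by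
  have h := sum_mul_eq_of_tildeMatrix_mulVec hAv i
  by_contra! h'
  have := div_nonpos_of_nonneg_of_nonpos
    (Finset.sum_nonneg fun j (_ : j ∈ Finset.univ) => mul_nonneg (hM i j) (hA j).le) h'
  have := mul_pos (Real.exp_pos v) (hA i)
  linarith

lemma card_pos_of_predCount_pos (hM : ∀ i j, 0 ≤ M i j) {i : T} (hi : 0 < predCount S M i) :
    (0 : ℝ) < S.card := by
  have : 0 ≤ ∑ j, M j i := Finset.sum_nonneg fun j _ => hM j i
  rw [predCount] at hi
  linarith

lemma mem_of_walkY_ne_zero {x y : ℤ × T} (h : walkY S M v A x y ≠ 0) :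
    y ∈ ({x.1 + 1, x.1 - 1} : Finset ℤ) ×ˢ (Finset.univ : Finset T) := by
  simpa using level_of_walkY_ne_zero h

lemma finiteRange_walkY : FiniteRange (walkY S M v A) := fun _ =>
  (Finset.finite_toSet _).subset fun _ hy => mem_of_walkY_ne_zero hy

lemma tsum_walkY_mul (x : ℤ × T) (f : ℤ × T → ℝ) :
    ∑' y, walkY S M v A x y * f y =
      ∑ i, M i x.2 / S.card * f (x.1 + 1, i) +
      ∑ i, Real.exp (-v) * (A i * M x.2 i / (A x.2 * S.card)) * f (x.1 - 1, i) := by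
  rw [tsum_eq_sum (s := ({x.1 + 1, x.1 - 1} : Finset ℤ) ×ˢ (Finset.univ : Finset T))
    fun y hy => by rw [not_not.1 fun h => hy (mem_of_walkY_ne_zero h), zero_mul]]
  rw [Finset.sum_product, Finset.sum_pair (by omega)]
  have h : x.1 - 1 ≠ x.1 + 1 := by omega
  simp [walkY, h]

lemma isTransitionProbability_walkY (hM : ∀ i j, 0 ≤ M i j) (hA : ∀ i, 0 < A i)
    (hAv : (tildeMatrix S M).mulVec A = Real.exp v • A) :
    IsTransitionProbability (walkY S M v A) := by
  refine ⟨walkY_nonneg hM hA, fun x => ?_⟩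
  have hp := predCount_pos hM hA hAv x.2
  have hS := card_pos_of_predCount_pos hM hp
  have hsum : Summable (walkY S M v A x) := by
    simpa using finiteRange_walkY.summable_mul x fun _ => 1
  convert hsum.hasSum
  have h := tsum_walkY_mul (S := S) (M := M) (v := v) (A := A) x fun _ => 1
  simp only [mul_one] at h
  have h2 := sum_mul_eq_of_tildeMatrix_mulVec hAv x.2
  rw [div_eq_iff hp.ne'] at h2
  have h3 : ∑ i, Real.exp (-v) * (A i * M x.2 i / (A x.2 * S.card)) =
      predCount S M x.2 / S.card := by
    rw [← Finset.mul_sum, ← Finset.sum_div]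
    simp_rw [mul_comm (A _)]
    rw [h2, Real.exp_neg]
    have := (hA x.2).ne'
    field_simp
  rw [h, h3, ← Finset.sum_div, predCount]
  field_simp
  ring

/-- A critical point `g` of the quadratic form gives the eigenfunction `(k, j) ↦ e^{-vk/2} g_j` of
the walk on `ℤ × T`. -/
lemma walkY_eigen {lam : ℝ} {g : T → ℝ} (hA : ∀ i, 0 < A i)
    (hg : ∀ k, ∑ i, M i k * A k * g i + ∑ i, M k i * A i * g i = 2 * lam * (A k * g k))
    (x : ℤ × T) :
    ∑' y, walkY S M v A x y * (Real.exp (-v / 2 * y.1) * g y.2) =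
      2 * Real.exp (-v / 2) * lam / S.card * (Real.exp (-v / 2 * x.1) * g x.2) := by
  rw [tsum_walkY_mul]
  have e1 : Real.exp (-v / 2 * ((x.1 + 1 : ℤ) : ℝ)) =
      Real.exp (-v / 2) * Real.exp (-v / 2 * x.1) := by
    rw [← Real.exp_add]
    push_cast
    ring_nf
  have e2 : Real.exp (-v) * Real.exp (-v / 2 * ((x.1 - 1 : ℤ) : ℝ)) =
      Real.exp (-v / 2) * Real.exp (-v / 2 * x.1) := by
    rw [← Real.exp_add, ← Real.exp_add]
    push_cast
    ring_nf
  have ha := (hA x.2).ne'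
  set E := Real.exp (-v / 2) * Real.exp (-v / 2 * x.1) with hE
  have s1 : ∑ i, M i x.2 / S.card * (Real.exp (-v / 2 * ((x.1 + 1 : ℤ) : ℝ)) * g i) =
      E / (A x.2 * S.card) * ∑ i, M i x.2 * A x.2 * g i := by
    rw [Finset.mul_sum]
    refine Finset.sum_congr rfl fun i _ => ?_
    rw [e1]
    rcases eq_or_ne (S.card : ℝ) 0 with h0 | h0
    · simp [h0]
    · field_simp
  have s2 : ∑ i, Real.exp (-v) * (A i * M x.2 i / (A x.2 * S.card)) *
      (Real.exp (-v / 2 * ((x.1 - 1 : ℤ) : ℝ)) * g i) =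
      E / (A x.2 * S.card) * ∑ i, M x.2 i * A i * g i := by
    rw [Finset.mul_sum, ← e2]
    exact Finset.sum_congr rfl fun i _ => by ring
  rw [s1, s2, ← mul_add, hg, hE]
  rcases eq_or_ne (S.card : ℝ) 0 with h0 | h0
  · simp [h0]
  · field_simp

/-- The spectral radius of the walk on `ℤ × T`. The walk moves at most `n` levels away in `n` steps,
and it has a positive eigenfunction `f` such that `m f ^ 2` is bounded, where `m` is the reversible
measure; so the return probabilities agree with the powers of the eigenvalue up
to a linear factor. -/
lemma hasSpectralRadius_walkY {lam : ℝ} {g : T → ℝ} (hM : ∀ i j, 0 ≤ M i j) (hA : ∀ i, 0 < A i)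
    (hlam : 0 ≤ lam) (g0 : ∀ i, 0 < g i)
    (hg : ∀ k, ∑ i, M i k * A k * g i + ∑ i, M k i * A i * g i = 2 * lam * (A k * g k)) :
    HasSpectralRadius (walkY S M v A) (2 * Real.exp (-v / 2) * lam / S.card) := by
  intro x
  set r := 2 * Real.exp (-v / 2) * lam / S.card with hr
  have r0 : 0 ≤ r := by positivity
  set f : ℤ × T → ℝ := fun y => Real.exp (-v / 2 * y.1) * g y.2 with hf
  have f0 : ∀ y, 0 < f y := fun y => mul_pos (Real.exp_pos _) (g0 _)
  set m : ℤ × T → ℝ := fun y => Real.exp (v * y.1) * A y.2 with hm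
  have m0 : ∀ y, 0 < m y := fun y => mul_pos (Real.exp_pos _) (hA _)
  have hmf : ∀ y, m y * f y ^ 2 = A y.2 * g y.2 ^ 2 := fun y => by
    have : Real.exp (v * y.1) * Real.exp (-v / 2 * y.1) ^ 2 = 1 := by
      rw [← Real.exp_nat_mul, ← Real.exp_add, Real.exp_eq_one_iff]
      push_cast
      ring
    simp only [hm, hf]
    linear_combination A y.2 * g y.2 ^ 2 * this
  have hterm : ∀ i, 0 ≤ A i * g i ^ 2 := fun i => mul_nonneg (hA i).le (sq_nonneg _)
  set C := ∑ i, A i * g i ^ 2 with hC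
  have hCle : ∀ y, m y * f y ^ 2 ≤ C := fun y => by
    rw [hmf]
    exact Finset.single_le_sum (f := fun i => A i * g i ^ 2) (fun i _ => hterm i)
      (Finset.mem_univ _)
  have hx : 0 < m x * f x ^ 2 := mul_pos (m0 x) (pow_pos (f0 x) 2)
  have hCpos : 0 < C := hx.trans_le (hCle x)
  have heig : ∀ x, ∑' z, walkY S M v A x z * f z = r * f x := walkY_eigen hA hg
  have hT : (0 : ℝ) < Fintype.card T := by exact_mod_cast Fintype.card_pos_iff.2 ⟨x.2⟩
  refine tendsto_root_of_bounds r0 (c := m x * f x ^ 2 / (Fintype.card T * C)) (by positivity)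
    (fun n => ?_) fun n => ?_
  · have h := finiteRange_walkY.le_nStep_two_mul m0 (walkY_reversible hA) heig (n := n) (x := x)
      (F := Finset.Icc (x.1 - n) (x.1 + n) ×ˢ Finset.univ)
      (fun y hy => Finset.mem_product.2 ⟨level_of_nStep_walkY_ne_zero hy, Finset.mem_univ _⟩) hCle
    have hcard : ((Finset.Icc (x.1 - n) (x.1 + n) ×ˢ (Finset.univ : Finset T)).card : ℝ) =
        (2 * n + 1) * Fintype.card T := by
      rw [Finset.card_product, Int.card_Icc, Finset.card_univ]
      have : (x.1 + n + 1 - (x.1 - n)).toNat = 2 * n + 1 := by omega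
      rw [this]
      push_cast
      ring
    rw [hcard] at h
    rw [div_div, div_mul_eq_mul_div, div_le_iff₀ (by positivity)]
    calc m x * f x ^ 2 * r ^ (2 * n) = (r ^ n) ^ 2 * (m x * f x ^ 2) := by ring
      _ ≤ _ := h
      _ = _ := by ring
  · have h := finiteRange_walkY.nStep_mul_le_of_eigen (walkY_nonneg hM hA) (fun y => (f0 y).le)
      heig (2 * n) x x
    exact le_of_mul_le_mul_right h (f0 x)

/-- The spectral radius of a Markov chain with finite range is at most one. -/
lemma HasSpectralRadius.le_one {X : Type*} {p : X → X → ℝ} (hp : FiniteRange p)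
    (h : IsTransitionProbability p) {ρ : ℝ} (hρ : HasSpectralRadius p ρ) (x : X) : ρ ≤ 1 := by
  refine le_of_tendsto' (hρ x) fun n => Real.rpow_le_one (nStep_nonneg h.1 _ _ _) ?_ (by positivity)
  simpa using hp.nStep_mul_le_of_eigen h.1 (f := fun _ => 1) (fun _ => zero_le_one) (r := 1)
    (fun x => by simpa using (h.2 x).tsum_eq) (2 * n) x x

end WalkY

/-! ### Bipartite graphs -/

section Bipartite

variable {V : Type*} {G : SimpleGraph V}

/-- In a graph without odd cycles, the parity of the length of a walk can be computed on a path: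
whenever the walk closes up, the piece that is removed is either an edge traversed twice or an even
cycle. -/
lemma SimpleGraph.Walk.exists_isPath_even_length_iff
    (hG : ∀ (x : V) (w : G.Walk x x), w.IsCycle → ¬ Odd w.length) {u v : V} (p : G.Walk u v) :
    ∃ q : G.Walk u v, q.IsPath ∧ (Even q.length ↔ Even p.length) := by
  classical
  induction p with
  | nil => exact ⟨.nil, by simp, Iff.rfl⟩
  | @cons u v w h p ih =>
    obtain ⟨q, hq, hpar⟩ := ih
    rw [length_cons, Nat.even_add_one, ← hpar]
    by_cases hu : u ∈ q.support
    · refine ⟨q.dropUntil u hu, hq.dropUntil hu, ?_⟩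
      have hlen : q.length = (q.takeUntil u hu).length + (q.dropUntil u hu).length := by
        rw [← length_append, take_spec]
      have hodd : Odd (q.takeUntil u hu).length := by
        have ht := hq.takeUntil hu
        by_cases he : s(u, v) ∈ (q.takeUntil u hu).edges
        · rw [ht.length_eq_one_of_mem_edges (Sym2.eq_swap ▸ he)]
          exact odd_one
        · have := hG u _ ((cons_isCycle_iff _ h).2 ⟨ht, he⟩)
          rwa [length_cons, Nat.odd_add_one, not_not] at this
      rw [hlen, Nat.even_add, ← Nat.not_odd_iff_even (n := (q.takeUntil u hu).length)]
      tauto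
    · exact ⟨.cons h q, hq.cons hu, by rw [length_cons, Nat.even_add_one]⟩

lemma SimpleGraph.Walk.even_length_of_forall_isCycle
    (hG : ∀ (x : V) (w : G.Walk x x), w.IsCycle → ¬ Odd w.length) {u : V} (p : G.Walk u u) :
    Even p.length := by
  obtain ⟨q, hq, h⟩ := p.exists_isPath_even_length_iff hG
  rw [← h, length_eq_zero_iff.2 (isPath_iff_nil.1 hq)]
  exact Even.zero

end Bipartite

/-! ### Spheres in Cayley graphs -/

section Cayley

variable {Γ : Type*} [Group Γ] {S : Finset Γ}

/-- The distance to the identity in the Cayley graph. -/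
noncomputable def wordLength (S : Finset Γ) (x : Γ) : ℕ :=
  (SimpleGraph.mulCayley (S : Set Γ)).dist 1 x

lemma mulCayley_adj_iff_mem (hS : ∀ s ∈ S, s⁻¹ ∈ S) (h1 : (1 : Γ) ∉ S) (x y : Γ) :
    (SimpleGraph.mulCayley (S : Set Γ)).Adj x y ↔ x⁻¹ * y ∈ S := by
  rw [SimpleGraph.mulCayley_adj]
  constructor
  · rintro ⟨-, h | h⟩
    · exact h
    · simpa using hS _ h
  · intro h
    refine ⟨?_, Or.inl h⟩
    rintro rfl
    exact h1 (by simpa using h)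

lemma mulCayley_reachable_one (hS : IsSymmetricGenerating S) (h1 : (1 : Γ) ∉ S) (x : Γ) :
    (SimpleGraph.mulCayley (S : Set Γ)).Reachable 1 x := by
  have hx : x ∈ Subgroup.closure (S : Set Γ) := hS.2 ▸ Subgroup.mem_top x
  induction hx using Subgroup.closure_induction_right with
  | one => rfl
  | mul_right x _ s hs ih =>
    exact ih.trans ((mulCayley_adj_iff_mem hS.1 h1 _ _).2 (by simpa using hs)).reachable
  | mul_inv_cancel x _ s hs ih =>
    exact ih.trans ((mulCayley_adj_iff_mem hS.1 h1 _ _).2 (by simpa using hS.1 s hs)).reachable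

lemma wordLength_adj (hS : IsSymmetricGenerating S) (hodd : NoOddCycle S) {x y : Γ}
    (h : x⁻¹ * y ∈ S) :
    wordLength S y = wordLength S x + 1 ∨ wordLength S x = wordLength S y + 1 := by
  have hadj := (mulCayley_adj_iff_mem hS.1 hodd.1 x y).2 h
  obtain ⟨p, hp⟩ := (mulCayley_reachable_one hS hodd.1 x).exists_walk_length_eq_dist
  obtain ⟨q, hq⟩ := (mulCayley_reachable_one hS hodd.1 y).exists_walk_length_eq_dist
  have heven := ((p.concat hadj).append q.reverse).even_length_of_forall_isCycle hodd.2
  rw [SimpleGraph.Walk.length_append, SimpleGraph.Walk.length_concat,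
    SimpleGraph.Walk.length_reverse, hp, hq] at heven
  have h1 := SimpleGraph.dist_le (p.concat hadj)
  have h2 := SimpleGraph.dist_le (q.concat hadj.symm)
  rw [SimpleGraph.Walk.length_concat] at h1 h2
  unfold wordLength
  grind

lemma finite_wordLength_eq (hS : IsSymmetricGenerating S) (h1 : (1 : Γ) ∉ S) (n : ℕ) :
    {x | wordLength S x = n}.Finite := by
  have h : ∀ n x,
      {y | ∃ w : (SimpleGraph.mulCayley (S : Set Γ)).Walk x y, w.length = n}.Finite := by
    intro n
    induction n with
    | zero =>
      refine fun x => (Set.finite_singleton x).subset ?_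
      rintro y ⟨w, hw⟩
      exact (SimpleGraph.Walk.eq_of_length_eq_zero hw).symm
    | succ n ih =>
      refine fun x => (S.finite_toSet.biUnion fun s _ => ih (x * s)).subset ?_
      rintro y ⟨w, hw⟩
      cases w with
      | nil => simp at hw
      | @cons _ z _ hz w =>
        have hz' := (mulCayley_adj_iff_mem hS.1 h1 _ _).1 hz
        rw [Set.mem_iUnion₂]
        refine ⟨x⁻¹ * z, hz', ?_⟩
        rw [mul_inv_cancel_left]
        exact ⟨w, by simpa using hw⟩
  refine (h n 1).subset fun x hx => ?_
  obtain ⟨p, hp⟩ := (mulCayley_reachable_one hS h1 x).exists_walk_length_eq_dist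
  exact ⟨p, hp.trans hx⟩

open Classical in
/-- The sphere of radius `n` in the Cayley graph; it is empty if the sphere is infinite, which
does not happen when `S` is a symmetric generating set without `1`. -/
noncomputable def wordSphere (S : Finset Γ) (n : ℕ) : Finset Γ :=
  if h : {x | wordLength S x = n}.Finite then h.toFinset else ∅

lemma mem_wordSphere (hS : IsSymmetricGenerating S) (h1 : (1 : Γ) ∉ S) {n : ℕ} {x : Γ} :
    x ∈ wordSphere S n ↔ wordLength S x = n := by
  rw [wordSphere, dif_pos (finite_wordLength_eq hS h1 n), Set.Finite.mem_toFinset]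
  rfl

end Cayley

/-! ### Type systems -/

section TypeSystem

variable {Γ T : Type*} [Group Γ] {S : Finset Γ} {t : Γ → T}

/-- Outside of a ball, all the points satisfy the condition of a type system. -/
lemma IsTypeSystem.exists_radius [Finite T] {M : Matrix T T ℝ}
    (hM : IsTypeSystem S t M) : ∃ n₀ : ℕ, ∀ x, n₀ ≤ wordLength S x →
    ∀ i, (({y | y ∈ successors S x ∧ t y = i}.ncard : ℕ) : ℝ) = M i (t x) := by
  have hfin := Set.finite_iUnion fun i => Set.finite_iUnion fun j => hM i j
  obtain ⟨b, hb⟩ := (hfin.image (wordLength S)).bddAbove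
  refine ⟨b + 1, fun x hx i => ?_⟩
  by_contra h
  have := hb ⟨x, Set.mem_iUnion.2 ⟨i, Set.mem_iUnion.2 ⟨t x, rfl, h⟩⟩, rfl⟩
  omega

variable [DecidableEq T]

/-- The probability to step from `x` to a successor of type `i`. -/
lemma sum_filter_simpleRandomWalk {M : Matrix T T ℝ} (hS : IsSymmetricGenerating S)
    (h1 : (1 : Γ) ∉ S) {x : Γ} {i : T}
    (hx : (({y | y ∈ successors S x ∧ t y = i}.ncard : ℕ) : ℝ) = M i (t x)) :
    ∑ y ∈ (wordSphere S (wordLength S x + 1)).filter (fun y => t y = i), simpleRandomWalk S x y =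
      M i (t x) / S.card := by
  classical
  have hset : {y | y ∈ successors S x ∧ t y = i} =
      (((wordSphere S (wordLength S x + 1)).filter (fun y => t y = i)).filter
        (fun y => x⁻¹ * y ∈ S) : Finset Γ) := by
    ext y
    simp only [Set.mem_ofPred_eq, Finset.coe_filter, Finset.mem_filter, mem_wordSphere hS h1,
      successors, mulCayley_adj_iff_mem hS.1 h1, wordLength]
    tauto
  rw [← hx, hset, Set.ncard_coe_finset, Finset.card_filter, Nat.cast_sum, Finset.sum_div]
  refine Finset.sum_congr rfl fun y _ => ?_
  unfold simpleRandomWalk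
  split_ifs <;> simp

/-- The number of points of type `j` on the sphere of radius `n`. -/
noncomputable def sphereCount (S : Finset Γ) (t : Γ → T) (n : ℕ) (j : T) : ℝ :=
  ((wordSphere S n).filter fun x => t x = j).card

variable [Fintype T] {M : Matrix T T ℝ}

lemma sum_wordSphere_comp (n : ℕ) (f : T → ℝ) :
    ∑ x ∈ wordSphere S n, f (t x) = ∑ j, sphereCount S t n j * f j := by
  rw [← Finset.sum_fiberwise (wordSphere S n) t]
  refine Finset.sum_congr rfl fun j _ => ?_
  rw [Finset.sum_congr rfl fun x hx => by rw [(Finset.mem_filter.1 hx).2], Finset.sum_const,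
    nsmul_eq_mul, sphereCount]

lemma sum_succ_simpleRandomWalk (hS : IsSymmetricGenerating S) (h1 : (1 : Γ) ∉ S) {x : Γ}
    (hx : ∀ i, (({y | y ∈ successors S x ∧ t y = i}.ncard : ℕ) : ℝ) = M i (t x)) (f : T → ℝ) :
    ∑ y ∈ wordSphere S (wordLength S x + 1), f (t y) * simpleRandomWalk S x y =
      ∑ i, f i * M i (t x) / S.card := by
  rw [← Finset.sum_fiberwise _ t]
  refine Finset.sum_congr rfl fun i _ => ?_
  rw [mul_div_assoc, ← sum_filter_simpleRandomWalk hS h1 (hx i), Finset.mul_sum]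
  exact Finset.sum_congr rfl fun y hy => by rw [(Finset.mem_filter.1 hy).2]

/-- The probability to step from `y` to a predecessor: as the graph is bipartite, the neighbours
of `y` which are not successors are predecessors. -/
lemma sum_pred_simpleRandomWalk (hS : IsSymmetricGenerating S) (hodd : NoOddCycle S)
    (hne : S.Nonempty) {n : ℕ} {y : Γ} (hn : wordLength S y = n + 1)
    (hy : ∀ i, (({z | z ∈ successors S y ∧ t z = i}.ncard : ℕ) : ℝ) = M i (t y)) :
    ∑ x ∈ wordSphere S n, simpleRandomWalk S y x = predCount S M (t y) / S.card := by
  classical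
  have hc : (S.card : ℝ) ≠ 0 := by exact_mod_cast hne.card_pos.ne'
  have htot := tsum_simpleRandomWalk_mul (S := S) y fun _ => 1
  rw [tsum_eq_sum (s := wordSphere S n ∪ wordSphere S (n + 2)) fun z hz => ?_] at htot
  · rw [Finset.sum_union ?_] at htot
    · have hsucc := sum_succ_simpleRandomWalk hS hodd.1 hy fun _ => 1
      rw [hn] at hsucc
      simp only [mul_one, one_mul, Finset.sum_const, nsmul_eq_mul, div_self hc] at htot hsucc
      rw [hsucc, ← Finset.sum_div] at htot
      rw [predCount, sub_div, div_self hc, ← htot]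
      ring
    · rw [Finset.disjoint_left]
      intro z h1 h2
      rw [mem_wordSphere hS hodd.1] at h1 h2
      omega
  · rw [mul_one, simpleRandomWalk, if_neg fun h => hz ?_]
    rw [Finset.mem_union, mem_wordSphere hS hodd.1, mem_wordSphere hS hodd.1]
    have := wordLength_adj hS hodd h
    omega

/-- The sizes of the spheres by type grow according to the matrix `M̃`, as is seen by counting the
edges between two consecutive spheres from both sides. -/
lemma sum_mul_sphereCount (hS : IsSymmetricGenerating S) (hodd : NoOddCycle S)
    (hne : S.Nonempty) {n : ℕ}
    (hn : ∀ x, n ≤ wordLength S x →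
      ∀ i, (({y | y ∈ successors S x ∧ t y = i}.ncard : ℕ) : ℝ) = M i (t x)) (i : T) :
    ∑ j, M i j * sphereCount S t n j = predCount S M i * sphereCount S t (n + 1) i := by
  have hc : (S.card : ℝ) ≠ 0 := by exact_mod_cast hne.card_pos.ne'
  have h1 : ∑ x ∈ wordSphere S n, ∑ y ∈ (wordSphere S (n + 1)).filter (fun y => t y = i),
      simpleRandomWalk S x y = ∑ j, sphereCount S t n j * (M i j / S.card) := by
    rw [← sum_wordSphere_comp n fun j => M i j / S.card]
    refine Finset.sum_congr rfl fun x hx => ?_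
    rw [mem_wordSphere hS hodd.1] at hx
    rw [← sum_filter_simpleRandomWalk hS hodd.1 (hn x hx.ge i), hx]
  rw [Finset.sum_comm] at h1
  have h2 : ∑ y ∈ (wordSphere S (n + 1)).filter (fun y => t y = i), ∑ x ∈ wordSphere S n,
      simpleRandomWalk S x y = sphereCount S t (n + 1) i * (predCount S M i / S.card) := by
    rw [sphereCount, ← nsmul_eq_mul, ← Finset.sum_const]
    refine Finset.sum_congr rfl fun y hy => ?_
    rw [Finset.mem_filter, mem_wordSphere hS hodd.1] at hy
    simp_rw [simpleRandomWalk_symm hS.1 _ y]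
    rw [sum_pred_simpleRandomWalk hS hodd hne hy.1 (hn y (by omega)), hy.2]
  rw [h2] at h1
  have h3 : ∑ j, sphereCount S t n j * (M i j / S.card) =
      (∑ j, M i j * sphereCount S t n j) / S.card := by
    rw [Finset.sum_div]
    exact Finset.sum_congr rfl fun j _ => by ring
  rw [h3, mul_div_assoc', div_left_inj' hc] at h1
  rw [← h1, mul_comm]

end TypeSystem

/-! ### Averages of the iterates of a primitive matrix -/

section Averages

lemma exists_pos_mul_le {T : Type*} [Finite T] [Nonempty T] {A x : T → ℝ} (hA : ∀ i, 0 < A i)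
    (hx : ∀ i, 0 < x i) : ∃ c, 0 < c ∧ (∀ i, c * A i ≤ x i) ∧ ∃ i, c * A i = x i := by
  obtain ⟨i, hi⟩ := Finite.exists_min fun i => x i / A i
  exact ⟨x i / A i, div_pos (hx i) (hA i), fun j => (le_div_iff₀ (hA j)).1 (hi j), i,
    div_mul_cancel₀ _ (hA i).ne'⟩

variable {T : Type*} [Fintype T] [DecidableEq T] {M : Matrix T T ℝ} {p : T → ℝ}

/-- Here `x (n + 1)` is the image of `x n` under the matrix `(M i j / p i)`. By primitivity, a
nonzero nonnegative vector is eventually mapped to a positive one. -/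
lemma exists_pos_of_recurrence (hPF : M.IsPrimitive) (hp : ∀ i, 0 < p i) {x : ℕ → T → ℝ}
    (x0 : ∀ n i, 0 ≤ x n i) (hx : ∀ n i, ∑ j, M i j * x n j = p i * x (n + 1) i)
    (hne : ∃ i, 0 < x 0 i) : ∃ k, ∀ i, 0 < x k i := by
  set K := ∑ i, p i with hK
  have K0 : 0 ≤ K := Finset.sum_nonneg fun i _ => (hp i).le
  have hpow : ∀ n m i, ∑ j, (M ^ n) i j * x m j ≤ K ^ n * x (m + n) i := fun n => by
    induction n with
    | zero => intro m i; simp [Matrix.one_apply]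
    | succ n ih =>
      intro m i
      calc ∑ j, (M ^ (n + 1)) i j * x m j = ∑ k, (M ^ n) i k * ∑ j, M k j * x m j := by
            simp_rw [pow_succ, Matrix.mul_apply, Finset.mul_sum, Finset.sum_mul]
            rw [Finset.sum_comm]
            exact Finset.sum_congr rfl fun _ _ => Finset.sum_congr rfl fun _ _ => by ring
        _ ≤ ∑ k, (M ^ n) i k * (K * x (m + 1) k) := by
            refine Finset.sum_le_sum fun k _ => mul_le_mul_of_nonneg_left ?_ ?_
            · rw [hx]
              exact mul_le_mul_of_nonneg_right
                (Finset.single_le_sum (fun i _ => (hp i).le) (Finset.mem_univ k)) (x0 _ _)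
            · exact Matrix.pow_apply_nonneg hPF.nonneg n i k
        _ = K * ∑ k, (M ^ n) i k * x (m + 1) k := by
            rw [Finset.mul_sum]
            exact Finset.sum_congr rfl fun _ _ => by ring
        _ ≤ K * (K ^ n * x (m + 1 + n) i) := mul_le_mul_of_nonneg_left (ih _ _) K0
        _ = _ := by rw [add_right_comm, add_assoc m]; ring
  obtain ⟨n, -, hn⟩ := hPF.exists_pos_pow
  obtain ⟨j, hj⟩ := hne
  refine ⟨n, fun i => ?_⟩
  have h1 : 0 < ∑ j, (M ^ n) i j * x 0 j := Finset.sum_pos'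
    (fun j _ => mul_nonneg (hn i j).le (x0 0 j)) ⟨j, Finset.mem_univ j, mul_pos (hn i j) hj⟩
  have h2 := h1.trans_le (hpow n 0 i)
  rw [zero_add] at h2
  exact pos_of_mul_pos_right h2 (pow_nonneg K0 n)

/-- The averages of the iterates `x n` of a positive vector under the matrix `(M i j / p i)`, for
which `A` is a positive fixed vector, converge along a subsequence to a positive multiple of `A`:
a limit point is a positive fixed vector, and there is only one up to scaling. -/
lemma exists_average_tendsto [Nonempty T] (hPF : M.IsPrimitive) (hp : ∀ i, 0 < p i) {A : T → ℝ}
    (hA : ∀ i, 0 < A i) (hAp : ∀ i, ∑ j, M i j * A j = p i * A i) {x : ℕ → T → ℝ}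
    (hx : ∀ n i, ∑ j, M i j * x n j = p i * x (n + 1) i) (x0 : ∀ i, 0 < x 0 i) :
    ∃ (c : ℝ) (ψ : ℕ → ℕ), 0 < c ∧
      (∀ j, Tendsto (fun k => (∑ n ∈ Finset.range (ψ k), x n j) / ψ k) atTop (𝓝 (c * A j))) ∧
      ∀ j, Tendsto (fun k => (∑ n ∈ Finset.range (ψ k + 1), x n j) / ψ k) atTop
        (𝓝 (c * A j)) := by
  obtain ⟨α, α0, hα, -⟩ := exists_pos_mul_le hA x0
  obtain ⟨β', β0, hβ', -⟩ := exists_pos_mul_le x0 hA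
  -- Multiples of `A` are fixed, so the bounds on `x 0` by such multiples persist.
  have hlow : ∀ n i, α * A i ≤ x n i := fun n => by
    induction n with
    | zero => exact hα
    | succ n ih =>
      intro i
      refine le_of_mul_le_mul_left ?_ (hp i)
      rw [← hx, mul_left_comm, ← hAp, Finset.mul_sum]
      refine Finset.sum_le_sum fun j _ => ?_
      rw [mul_left_comm]
      exact mul_le_mul_of_nonneg_left (ih j) (hPF.nonneg i j)
  have hup' : ∀ n i, β' * x n i ≤ A i := fun n => by
    induction n with
    | zero => exact hβ'
    | succ n ih =>
      intro i
      refine le_of_mul_le_mul_left ?_ (hp i)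
      rw [← hAp, mul_left_comm, ← hx, Finset.mul_sum]
      refine Finset.sum_le_sum fun j _ => ?_
      rw [mul_left_comm]
      exact mul_le_mul_of_nonneg_left (ih j) (hPF.nonneg i j)
  have hup : ∀ n i, x n i ≤ β'⁻¹ * A i := fun n i => by
    rw [inv_mul_eq_div, le_div_iff₀ β0, mul_comm]
    exact hup' n i
  set w : ℕ → T → ℝ := fun L j => (∑ n ∈ Finset.range (L + 1), x n j) / ((L + 1 : ℕ) : ℝ) with hw
  have hwmem : ∀ L, w L ∈ Set.Icc (fun i => α * A i) (fun i => β'⁻¹ * A i) := fun L => by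
    have hL : (0 : ℝ) < ((L + 1 : ℕ) : ℝ) := by positivity
    refine ⟨fun i => ?_, fun i => ?_⟩
    · simp only [hw]
      rw [le_div_iff₀ hL, mul_comm]
      simpa using Finset.card_nsmul_le_sum (Finset.range (L + 1)) (fun n => x n i) _
        fun n _ => hlow n i
    · simp only [hw]
      rw [div_le_iff₀ hL, mul_comm]
      simpa using Finset.sum_le_card_nsmul (Finset.range (L + 1)) (fun n => x n i) _
        fun n _ => hup n i
  obtain ⟨w', hw', φ, hφ, hlim⟩ := isCompact_Icc.tendsto_subseq hwmem
  have hlim' : ∀ j, Tendsto (fun k => w (φ k) j) atTop (𝓝 (w' j)) := tendsto_pi_nhds.1 hlim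
  have hbdry : ∀ (y : ℕ → ℝ) (C : ℝ), (∀ n, |y n| ≤ C) →
      Tendsto (fun k => y (φ k + 1) / ((φ k + 1 : ℕ) : ℝ)) atTop (𝓝 0) := fun y C hy => by
    have h1 : Tendsto (fun n : ℕ => y n / n) atTop (𝓝 0) := by
      refine squeeze_zero_norm (fun n => ?_) (tendsto_const_div_atTop_nhds_zero_nat C)
      rw [norm_div, Real.norm_natCast, Real.norm_eq_abs]
      exact div_le_div_of_nonneg_right (hy n) n.cast_nonneg
    exact h1.comp ((tendsto_add_atTop_nat 1).comp hφ.tendsto_atTop)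
  have hxpos : ∀ n i, 0 < x n i := fun n i => (mul_pos α0 (hA i)).trans_le (hlow n i)
  have habs : ∀ i n, |x n i| ≤ β'⁻¹ * A i := fun i n => by
    rw [abs_of_pos (hxpos n i)]
    exact hup n i
  -- The limit is a fixed vector, since shifting the sequence changes the averages by `O(1 / L)`.
  have hfix : ∀ i, ∑ j, M i j * w' j = p i * w' i := fun i => by
    have h1 : Tendsto (fun k => ∑ j, M i j * w (φ k) j) atTop (𝓝 (∑ j, M i j * w' j)) :=
      tendsto_finsetSum _ fun j _ => (hlim' j).const_mul _
    have h2 : Tendsto (fun k => p i * (w (φ k) i +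
        (x (φ k + 1) i - x 0 i) / ((φ k + 1 : ℕ) : ℝ))) atTop (𝓝 (p i * (w' i + 0))) := by
      refine ((hlim' i).add ?_).const_mul _
      refine hbdry (fun n => x n i - x 0 i) (β'⁻¹ * A i + β'⁻¹ * A i) fun n => ?_
      exact (abs_sub _ _).trans (add_le_add (habs i n) (habs i 0))
    rw [add_zero] at h2
    refine tendsto_nhds_unique h1 (h2.congr fun k => ?_)
    have h3 : ∑ n ∈ Finset.range (φ k + 1), x n i + (x (φ k + 1) i - x 0 i) =
        ∑ n ∈ Finset.range (φ k + 1), x (n + 1) i := by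
      rw [Finset.sum_range_succ' (fun n => x n i), Finset.sum_range_succ (fun n => x (n + 1) i)]
      ring
    simp only [hw]
    rw [← add_div, h3, mul_div_assoc', Finset.mul_sum]
    simp_rw [← hx, mul_div_assoc', ← Finset.sum_div, Finset.mul_sum]
    rw [Finset.sum_comm]
  have hwpos : ∀ i, 0 < w' i := fun i => (mul_pos α0 (hA i)).trans_le (hw'.1 i)
  obtain ⟨c, c0, hc, i₀, hi₀⟩ := exists_pos_mul_le hA hwpos
  -- `w' - c A` is a nonnegative fixed vector with a zero entry; if it were nonzero, its iterates
  -- would become positive.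
  have hcw : ∀ i, w' i = c * A i := fun i => by
    by_contra h
    obtain ⟨k, hk⟩ := exists_pos_of_recurrence hPF hp (x := fun _ j => w' j - c * A j)
      (fun _ j => sub_nonneg.2 (hc j))
      (fun _ i => by
        simp_rw [mul_sub, mul_left_comm _ c, Finset.sum_sub_distrib, ← Finset.mul_sum, hfix, hAp])
      ⟨i, sub_pos.2 ((hc i).lt_of_ne (Ne.symm h))⟩
    exact (hk i₀).ne' (by rw [hi₀, sub_self])
  refine ⟨c, fun k => φ k + 1, c0, fun j => ?_, fun j => ?_⟩
  · rw [← hcw]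
    exact hlim' j
  · rw [← hcw]
    have h := (hlim' j).add (hbdry (fun n => x n j) _ (habs j))
    rw [add_zero] at h
    refine h.congr fun k => ?_
    rw [Finset.sum_range_succ _ (φ k + 1), add_div]

end Averages

/-! ### Comparison of the spectral radii -/

section Comparison

lemma two_mul_sum_le_sum_range {c : ℕ → ℕ → ℝ} (c0 : ∀ m n, 0 ≤ c m n)
    (hc : ∀ m n, c m n = c n m) (L : ℕ) :
    2 * ∑ n ∈ Finset.range L, c n (n + 1) ≤
      ∑ m ∈ Finset.range (L + 1), ∑ n ∈ Finset.range (L + 1), c m n := by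
  induction L with
  | zero => simp [c0]
  | succ L ih =>
    rw [Finset.sum_range_succ (fun m => ∑ n ∈ Finset.range (L + 1 + 1), c m n) (L + 1)]
    simp_rw [Finset.sum_range_succ (fun n => c _ n) (L + 1)]
    rw [Finset.sum_add_distrib, Finset.sum_range_succ (fun n => c n (n + 1)) L]
    have h1 := Finset.single_le_sum (f := fun m => c m (L + 1)) (fun m _ => c0 m _)
      (Finset.mem_range.2 L.lt_succ_self)
    have h2 := Finset.single_le_sum (f := fun n => c (L + 1) n) (fun n _ => c0 _ n)
      (Finset.mem_range.2 L.lt_succ_self)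
    have h3 := c0 (L + 1) (L + 1)
    have h4 := hc L (L + 1)
    linarith

variable {Γ T : Type*} [Group Γ] [Fintype T] [DecidableEq T] {S : Finset Γ} {t : Γ → T}
  {M : Matrix T T ℝ} {v : ℝ} {A : T → ℝ}

/-- The Rayleigh quotient of the function `x ↦ e^{-v|x|/2} g_{t(x)}`, restricted to the points with
`a ≤ |x| ≤ a + L`. -/
lemma HasSpectralRadius.rayleigh_le_of_typeSystem (hS : IsSymmetricGenerating S)
    (hodd : NoOddCycle S) {ρ : ℝ} (hρ : HasSpectralRadius (simpleRandomWalk S) ρ) {a : ℕ}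
    (ha : ∀ x, a ≤ wordLength S x →
      ∀ i, (({y | y ∈ successors S x ∧ t y = i}.ncard : ℕ) : ℝ) = M i (t x))
    (v : ℝ) {g : T → ℝ} (g0 : ∀ i, 0 < g i) (L : ℕ) :
    2 * Real.exp (-v / 2) / S.card * ∑ j, (∑ n ∈ Finset.range L,
        Real.exp (-v * (a + n : ℕ)) * sphereCount S t (a + n) j) * (g j * ∑ i, g i * M i j) ≤
      ρ * ∑ j, (∑ n ∈ Finset.range (L + 1),
        Real.exp (-v * (a + n : ℕ)) * sphereCount S t (a + n) j) * g j ^ 2 := by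
  classical
  set b : ℕ → ℝ := fun n => Real.exp (-v / 2 * n) with hb
  set f : Γ → ℝ := fun x => b (wordLength S x) * g (t x) with hf
  have f0 : ∀ x, 0 ≤ f x := fun x => mul_nonneg (Real.exp_pos _).le (g0 _).le
  set W : ℕ → Finset Γ := fun n => wordSphere S (a + n) with hW
  have hmem : ∀ {n x}, x ∈ W n → wordLength S x = a + n := fun h => (mem_wordSphere hS hodd.1).1 h
  have hdisj : ∀ s : Set ℕ, s.PairwiseDisjoint W := fun s m _ n _ hmn => by
    refine Finset.disjoint_left.2 fun x h1 h2 => hmn ?_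
    have := hmem h1
    have := hmem h2
    omega
  have hray := hρ.rayleigh_le hS.1 ((Finset.range (L + 1)).biUnion W) f0
  simp_rw [Finset.sum_biUnion (hdisj _)] at hray
  have hnorm : ∑ n ∈ Finset.range (L + 1), ∑ x ∈ W n, f x ^ 2 =
      ∑ j, (∑ n ∈ Finset.range (L + 1),
        Real.exp (-v * (a + n : ℕ)) * sphereCount S t (a + n) j) * g j ^ 2 := by
    simp_rw [Finset.sum_mul]
    rw [Finset.sum_comm (s := Finset.univ)]
    refine Finset.sum_congr rfl fun n _ => ?_
    have h1 : ∀ x ∈ W n, f x ^ 2 = Real.exp (-v * (a + n : ℕ)) * g (t x) ^ 2 := fun x hx => by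
      simp only [hf, hb, hmem hx]
      rw [mul_pow, ← Real.exp_nat_mul]
      push_cast
      ring_nf
    rw [Finset.sum_congr rfl h1,
      sum_wordSphere_comp (a + n) fun j => Real.exp (-v * (a + n : ℕ)) * g j ^ 2]
    exact Finset.sum_congr rfl fun j _ => by ring
  set c : ℕ → ℕ → ℝ := fun m n =>
    ∑ x ∈ W m, ∑ y ∈ W n, f x * f y * simpleRandomWalk S x y with hc
  have hcsucc : ∀ n, c n (n + 1) = Real.exp (-v / 2) / S.card * ∑ j,
      Real.exp (-v * (a + n : ℕ)) * sphereCount S t (a + n) j * (g j * ∑ i, g i * M i j) := by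
    intro n
    have h1 : ∀ x ∈ W n, ∑ y ∈ W (n + 1), f x * f y * simpleRandomWalk S x y =
        Real.exp (-v / 2) / S.card * (Real.exp (-v * (a + n : ℕ)) *
          (g (t x) * ∑ i, g i * M i (t x))) := by
      intro x hx
      have h2 := sum_succ_simpleRandomWalk hS hodd.1 (ha x (by rw [hmem hx]; omega)) g
      rw [hmem hx] at h2
      have h3 : ∀ y ∈ W (n + 1), f x * f y * simpleRandomWalk S x y =
          b (a + n) * b (a + (n + 1)) * g (t x) * (g (t y) * simpleRandomWalk S x y) := by
        intro y hy
        simp only [hf, hmem hx, hmem hy]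
        ring
      have h4 : b (a + n) * b (a + (n + 1)) =
          Real.exp (-v / 2) * Real.exp (-v * (a + n : ℕ)) := by
        simp only [hb]
        rw [← Real.exp_add, ← Real.exp_add]
        push_cast
        ring_nf
      rw [Finset.sum_congr rfl h3, ← Finset.mul_sum, h4]
      change _ * ∑ y ∈ wordSphere S (a + n + 1), _ = _
      rw [h2, ← Finset.sum_div]
      ring
    simp only [hc]
    rw [Finset.sum_congr rfl h1, sum_wordSphere_comp (a + n) fun j => Real.exp (-v / 2) / S.card *
      (Real.exp (-v * (a + n : ℕ)) * (g j * ∑ i, g i * M i j)), Finset.mul_sum]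
    exact Finset.sum_congr rfl fun j _ => by ring
  have hc0 : ∀ m n, 0 ≤ c m n := fun m n => Finset.sum_nonneg fun x _ =>
    Finset.sum_nonneg fun y _ =>
      mul_nonneg (mul_nonneg (f0 x) (f0 y)) (simpleRandomWalk_nonneg x y)
  have hcsymm : ∀ m n, c m n = c n m := fun m n => by
    simp only [hc]
    rw [Finset.sum_comm]
    refine Finset.sum_congr rfl fun x _ => Finset.sum_congr rfl fun y _ => ?_
    rw [simpleRandomWalk_symm hS.1, mul_comm (f y)]
  have hedges : ∑ m ∈ Finset.range (L + 1), ∑ n ∈ Finset.range (L + 1), c m n =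
      ∑ m ∈ Finset.range (L + 1), ∑ x ∈ W m, ∑ n ∈ Finset.range (L + 1), ∑ y ∈ W n,
        f x * f y * simpleRandomWalk S x y :=
    Finset.sum_congr rfl fun m _ => Finset.sum_comm
  have hlow := two_mul_sum_le_sum_range hc0 hcsymm L
  rw [hedges] at hlow
  rw [hnorm] at hray
  refine le_trans (le_of_eq ?_) (hlow.trans hray)
  simp_rw [hcsucc, Finset.sum_mul]
  rw [Finset.sum_comm, ← Finset.mul_sum]
  ring

/-- On a finite group the constant functions show that the spectral radius is at least one. -/
lemma HasSpectralRadius.one_le_of_finite [Finite Γ] (hS : ∀ s ∈ S, s⁻¹ ∈ S) (hne : S.Nonempty)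
    {ρ : ℝ} (hρ : HasSpectralRadius (simpleRandomWalk S) ρ) : 1 ≤ ρ := by
  have := Fintype.ofFinite Γ
  have hc : (S.card : ℝ) ≠ 0 := by exact_mod_cast hne.card_pos.ne'
  have h := hρ.rayleigh_le hS Finset.univ (f := fun _ => 1) fun _ => zero_le_one
  have h1 : ∀ x, ∑ y, simpleRandomWalk S x y = 1 := fun x => by
    have := tsum_simpleRandomWalk_mul (S := S) x fun _ => 1
    rw [tsum_fintype] at this
    simpa [hc] using this
  simp only [one_mul, h1, one_pow] at h
  have hpos : (0 : ℝ) < ∑ _x : Γ, (1 : ℝ) :=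
    Finset.sum_pos (fun _ _ => one_pos) Finset.univ_nonempty
  exact le_of_mul_le_mul_right (by rwa [one_mul]) hpos

/-- On an infinite group, the Rayleigh quotients of the test functions converge to the spectral
radius of the walk on `ℤ × T`, because the rescaled numbers of points of each type on the spheres
are in the average proportional to `A`. -/
lemma HasSpectralRadius.le_of_infinite [Infinite Γ] (hS : IsSymmetricGenerating S)
    (hodd : NoOddCycle S) (hM : IsTypeSystem S t M) (hPF : M.IsPrimitive) (hA : ∀ i, 0 < A i)
    (hAv : (tildeMatrix S M).mulVec A = Real.exp v • A) {lam : ℝ} {g : T → ℝ} (g0 : ∀ i, 0 < g i)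
    (hg : typeForm M A g = lam * ∑ i, A i * g i ^ 2) {ρ : ℝ}
    (hρ : HasSpectralRadius (simpleRandomWalk S) ρ) :
    2 * Real.exp (-v / 2) * lam / S.card ≤ ρ := by
  have : Nonempty T := ⟨t 1⟩
  have hpred := predCount_pos hPF.nonneg hA hAv
  have hcard := card_pos_of_predCount_pos hPF.nonneg (hpred (t 1))
  have hne : S.Nonempty := Finset.card_pos.1 (by exact_mod_cast hcard)
  obtain ⟨n₀, hn₀⟩ := hM.exists_radius
  set p : T → ℝ := fun i => predCount S M i * Real.exp v with hpdef
  have hp : ∀ i, 0 < p i := fun i => mul_pos (hpred i) (Real.exp_pos v)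
  have hAp : ∀ i, ∑ j, M i j * A j = p i * A i := fun i => by
    have h := sum_mul_eq_of_tildeMatrix_mulVec hAv i
    rw [div_eq_iff (hpred i).ne'] at h
    rw [h]
    ring
  set x : ℕ → ℕ → T → ℝ := fun a n j =>
    Real.exp (-v * (a + n : ℕ)) * sphereCount S t (a + n) j with hxdef
  have x0 : ∀ a n j, 0 ≤ x a n j := fun a n j =>
    mul_nonneg (Real.exp_pos _).le (Nat.cast_nonneg _)
  have hx : ∀ a, n₀ ≤ a → ∀ n i, ∑ j, M i j * x a n j = p i * x a (n + 1) i := by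
    intro a ha n i
    have h := sum_mul_sphereCount hS hodd hne (t := t) (n := a + n)
      (fun y hy => hn₀ y (by omega)) i
    have he : Real.exp v * Real.exp (-v * (a + (n + 1) : ℕ)) = Real.exp (-v * (a + n : ℕ)) := by
      rw [← Real.exp_add]
      push_cast
      ring_nf
    simp only [hxdef, hpdef]
    simp_rw [mul_left_comm (M i _)]
    rw [← Finset.mul_sum, h, ← he, add_assoc]
    ring
  -- Since the group is infinite, there are points outside of every ball.
  obtain ⟨y, hy⟩ : ∃ y, n₀ ≤ wordLength S y := by
    by_contra! h
    refine Set.infinite_univ ((Set.Finite.biUnion (Set.finite_Iio n₀) fun n _ =>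
      finite_wordLength_eq hS hodd.1 n).subset fun y _ => ?_)
    exact Set.mem_iUnion₂.2 ⟨wordLength S y, h y, rfl⟩
  obtain ⟨k, hk⟩ := exists_pos_of_recurrence hPF hp (x0 _) (hx _ hy) ⟨t y, by
    refine mul_pos (Real.exp_pos _) (Nat.cast_pos.2 (Finset.card_pos.2 ⟨y, ?_⟩))
    simp [mem_wordSphere hS hodd.1]⟩
  -- From the radius `a` on, every type occurs on every sphere.
  set a := wordLength S y + k with ha
  obtain ⟨c, ψ, c0, hψ, hψ'⟩ := exists_average_tendsto hPF hp hA hAp (hx a (by omega)) hk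
  have hlim1 : Tendsto (fun k => 2 * Real.exp (-v / 2) / S.card *
      ∑ j, (∑ n ∈ Finset.range (ψ k), x a n j) / ψ k * (g j * ∑ i, g i * M i j)) atTop
      (𝓝 (2 * Real.exp (-v / 2) / S.card * ∑ j, c * A j * (g j * ∑ i, g i * M i j))) :=
    (tendsto_finsetSum _ fun j _ => (hψ j).mul_const _).const_mul _
  have hlim2 : Tendsto (fun k => ρ * ∑ j, (∑ n ∈ Finset.range (ψ k + 1), x a n j) / ψ k * g j ^ 2)
      atTop (𝓝 (ρ * ∑ j, c * A j * g j ^ 2)) :=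
    (tendsto_finsetSum _ fun j _ => (hψ' j).mul_const _).const_mul _
  have hle := le_of_tendsto_of_tendsto' hlim1 hlim2 fun k => by
    have h := hρ.rayleigh_le_of_typeSystem hS hodd (a := a) (fun z hz => hn₀ z (by omega)) v g0
      (ψ k)
    have h' := div_le_div_of_nonneg_right h (Nat.cast_nonneg (α := ℝ) (ψ k))
    have hdiv : ∀ (u f : T → ℝ), ∑ j, u j / ψ k * f j = (∑ j, u j * f j) / ψ k := fun u f => by
      rw [Finset.sum_div]
      exact Finset.sum_congr rfl fun j _ => by ring
    rw [hdiv, hdiv, mul_div_assoc', mul_div_assoc']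
    exact h'
  set N := ∑ i, A i * g i ^ 2 with hN
  have hNpos : 0 < N := Finset.sum_pos (fun i _ => mul_pos (hA i) (pow_pos (g0 i) 2))
    Finset.univ_nonempty
  have e1 : ∑ j, c * A j * (g j * ∑ i, g i * M i j) = c * (lam * N) := by
    rw [← hg, typeForm, Finset.sum_comm, Finset.mul_sum]
    refine Finset.sum_congr rfl fun j _ => ?_
    rw [Finset.mul_sum, Finset.mul_sum, Finset.mul_sum]
    exact Finset.sum_congr rfl fun i _ => by ring
  have e2 : ∑ j, c * A j * g j ^ 2 = c * N := by
    rw [hN, Finset.mul_sum]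
    exact Finset.sum_congr rfl fun j _ => by ring
  rw [e1, e2] at hle
  refine le_of_mul_le_mul_right ?_ (mul_pos c0 hNpos)
  calc _ = 2 * Real.exp (-v / 2) / S.card * (c * (lam * N)) := by ring
    _ ≤ _ := hle

end Comparison

theorem mainTheorem3 {Γ T : Type*} [Group Γ] [Fintype T] [DecidableEq T]
    (S : Finset Γ) (hS : IsSymmetricGenerating S) (hodd : NoOddCycle S)
    (t : Γ → T) (M : Matrix T T ℝ) (hM : IsTypeSystem S t M) (hPF : M.IsPrimitive)
    (v : ℝ) (hv : IsDominatingEigenvalue (tildeMatrix S M) (Real.exp v))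
    (A : T → ℝ) (hA : ∀ i, 0 < A i) (hAv : (tildeMatrix S M).mulVec A = Real.exp v • A)
    (lam : ℝ) (hlam : IsGreatest (sphereValues (primeMatrix A M)) lam) :
    IsTransitionProbability (walkY S M v A) ∧
    ∃ ρY ρΓ : ℝ,
      HasSpectralRadius (walkY S M v A) ρY ∧
      ρY = 2 * Real.exp (-v / 2) * lam / (S.card : ℝ) ∧
      HasSpectralRadius (simpleRandomWalk S) ρΓ ∧
      ρΓ ≥ ρY := by
  have htrans := isTransitionProbability_walkY hPF.nonneg hA hAv
  have hcard := card_pos_of_predCount_pos hPF.nonneg (predCount_pos hPF.nonneg hA hAv (t 1))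
  have hne : S.Nonempty := Finset.card_pos.1 (by exact_mod_cast hcard)
  obtain ⟨lam0, g, g0, hg⟩ := exists_pos_typeForm_eq hPF hA hlam
  have hY : HasSpectralRadius (walkY S M v A) (2 * Real.exp (-v / 2) * lam / S.card) :=
    hasSpectralRadius_walkY hPF.nonneg hA lam0 g0 (typeForm_critical (typeForm_le hA hlam) hg)
  obtain ⟨ρ, hρ⟩ := exists_hasSpectralRadius_simpleRandomWalk hS.1 hne
  refine ⟨htrans, _, ρ, hY, rfl, hρ, ?_⟩
  rcases finite_or_infinite Γ with h | h
  · exact (hY.le_one finiteRange_walkY htrans (0, t 1)).trans (hρ.one_le_of_finite hS.1 hne)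
  · exact hρ.le_of_infinite hS hodd hM hPF hA hAv g0 hg
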